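/- Let $\mathbb F$ be a field of characteristic $0$. A \emph{finite-dimensionally graded vertex algebra} is a $\mathbb Z$-graded vector space $V=\coprod_{k\in\mathbb Z}V_{(k)}$ over $\mathbb F$ with $\dim V_{(k)}<\infty$ for all $k$ and $V_{(k)}=0$ for $k\ll 0$, together with a vertex algebra structure $(V,Y,\mathbf 1)$, i.e. a linear map $Y(\cdot,x):V\to(\operatorname{End}V)[[x,x^{-1}]]$ and a vector $\mathbf 1\in V$ with $Y(u,x)v\in V((x))$, $Y(\mathbf 1,x)=\mathrm{Id}_V$, $Y(v,x)\mathbf 1\in V[[x]]$, $\lim_{x\to0}Y(v,x)\mathbf 1=v$, and the Jacobi identity $$x_0^{-1}\delta\Big(\tfrac{x_1-x_2}{x_0}\Big)Y(u,x_1)Y(v,x_2)-x_0^{-1}\delta\Big(\tfrac{x_2-x_1}{-x_0}\Big)Y(v,x_2)Y(u,x_1)=x_2^{-1}\delta\Big(\tfrac{x_1-x_0}{x_2}\Big)Y(Y(u,x_0)v,x_2),$$ such that, writing $Y(u,x)=\sum_n u_nx^{-n-1}$, one has $u_nv\in V_{(j+k-n-1)}$ for $u\in V_{(j)}$, $v\in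 V_{(k)}$. Here $\delta(x)=\sum_{n\in\mathbb Z}x^n$ and $(x_i-x_j)^n$ is expanded in nonnegative powers of $x_j$. Morphisms are degree-preserving linear maps $f$ with $f(\mathbf 1)=\mathbf 1$ and $f(Y(u,x)v)=Y(f(u),x)f(v)$. A \emph{finite-dimensionally graded vertex coalgebra} is a $\mathbb Z$-graded vector space $V$ with the same finiteness conditions, together with linear maps $\Delta(x)=\sum_k\Delta_kx^{-k-1}:V\to(V\otimes V)[[x,x^{-1}]]$ and $c:V\to\mathbb F$ such that, for all $v\in V$, $(c\otimes\mathrm{Id})\Delta(x)v=v$; $(\mathrm{Id}\otimes c)\Delta(x)v\in V[[x]]$ with limit $v$ as $x\to0$; $\Delta(x)v\in(V\otimes V)((x^{-1}))$; $$x_0^{-1}\delta\Big(\tfrac{x_1-x_2}{x_0}\Big)(\mathrm{Id}\otimes\Delta(x_2))\Delta(x_1)-x_0^{-1}\delta\Big(\tfrac{x_2-x_1}{-x_0}\Big)(T\otimes\mathrm{Id})(\mathrm{Id}\otimes\Delta(x_1))\Delta(x_2)=x_2^{-1}\delta\Big(\tfrac{x_1-x_0}{x_2}\Big)(\Delta(x_0)\otimes\mathrm{Id})\Delta(x_2),$$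 where $T(u\otimes v)=v\otimes u$; and $\Delta_k(v)\in(V\otimes V)_{(r+k+1)}$ for $v\in V_{(r)}$. Morphisms are degree-preserving linear maps $f$ with $c\circ f=c$ and $(f\otimes f)\Delta(x)=\Delta(x)f$. Then graded dualization is a contravariant equivalence between these two categories. That is, there is an equivalence from the opposite of the category of finite-dimensionally graded vertex algebras to the category of finite-dimensionally graded vertex coalgebras such that, naturally in the object: (i) it sends $(V,Y,\mathbf 1)$ to the graded dual $V'=\coprod_kV_{(k)}^*$ with the structure determined by $\langle\Delta(x)u',v\otimes w\rangle=\langle u',Y(v,x)w\rangle$ and $c(u')=\langle u',\mathbf 1\rangle$, and morphisms to their transposes; (ii) its quasi-inverse sends $(V,\Delta,c)$ to $V'$ with the structure determined by $\langle Y(f,x)g,w\rangle=\langle f\otimes g,\Delta(x)w\rangle$ and $\langle\mathbf 1,w\rangle=c(w)$, and morphisms to their transposes; (iii) the unit and counit of the equivalence are given by the canonical isomorphisms $V\cong V''$. -/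

import Mathlib

open CategoryTheory Opposite TensorProduct DirectSum

universe u v

namespace VertexDuality

noncomputable section

/-! ### Formal calculus

A formal series `∑ n ∈ ℤ, w_n x ^ n` in `W[[x, x⁻¹]]` is its coefficient function `ℤ → W`, `n ↦ w_n`
(the index is the exponent of `x`). -/

/-- The coefficient of `z ^ a * x ^ b * y ^ c` in
`z⁻¹ δ((x - y) / z) = ∑ n ∈ ℤ, z ^ (-n - 1) * (x - y) ^ n`,
where `(x - y) ^ n = ∑ i ≥ 0, (-1) ^ i * (n choose i) * x ^ (n - i) * y ^ i`. -/
def deltaCoeff (a b c : ℤ) : ℤ :=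
  if 0 ≤ c ∧ a + b + c = -1 then (-1) ^ c.toNat * Ring.choose (b + c) c.toNat else 0

/-- The coefficient of `z ^ a * x ^ b * y ^ c` in
`z⁻¹ δ((x - y) / (-z)) = ∑ n ∈ ℤ, (-1) ^ n * z ^ (-n - 1) * (x - y) ^ n`. -/
def deltaCoeffNeg (a b c : ℤ) : ℤ :=
  ((a + 1).negOnePow : ℤ) * deltaCoeff a b c

/-! ### Vertex algebras and vertex coalgebras -/

/-- A vertex algebra structure on the vector space `V`. `Y u n` is the coefficient of `x ^ n` in
`Y(u, x)`, that is, the mode `u_{-n-1}`. -/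
structure VertexAlgebra (F : Type u) (V : Type v) [Field F] [AddCommGroup V] [Module F V] where
  /-- The vertex operator map `V → (End V)[[x, x⁻¹]]`. -/
  Y : V →ₗ[F] (ℤ → Module.End F V)
  /-- The vacuum vector `𝟏`. -/
  vac : V
  /-- `Y(u, x) v ∈ V((x))`. -/
  truncation : ∀ u v : V, ∃ N : ℤ, ∀ n < N, Y u n v = 0
  /-- `Y(𝟏, x) v = v`. -/
  vacuum : ∀ (v : V) (n : ℤ), Y vac n v = if n = 0 then v else 0
  /-- `Y(v, x) 𝟏 ∈ V[[x]]`. -/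
  creation : ∀ (v : V), ∀ n < 0, Y v n vac = 0
  /-- `lim_{x → 0} Y(v, x) 𝟏 = v`. -/
  creation_zero : ∀ v : V, Y v 0 vac = v
  /-- The Jacobi identity: equality of the coefficients of `x₀ ^ a * x₁ ^ b * x₂ ^ c` in
  `x₀⁻¹ δ((x₁ - x₂) / x₀) Y(u, x₁) Y(v, x₂) w - x₀⁻¹ δ((x₂ - x₁) / (-x₀)) Y(v, x₂) Y(u, x₁) w`
  and `x₂⁻¹ δ((x₁ - x₀) / x₂) Y(Y(u, x₀) v, x₂) w`. The sums have finite support by truncation. -/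
  jacobi : ∀ (u v w : V) (a b c : ℤ),
    (∑ᶠ p : ℤ × ℤ, deltaCoeff a p.1 p.2 • Y u (b - p.1) (Y v (c - p.2) w))
      - (∑ᶠ p : ℤ × ℤ, deltaCoeffNeg a p.2 p.1 • Y v (c - p.2) (Y u (b - p.1) w))
      = ∑ᶠ p : ℤ × ℤ, deltaCoeff p.2 b p.1 • Y (Y u (a - p.1) v) (c - p.2) w

/-- A vertex coalgebra structure on the vector space `V`. `Y v n` is the coefficient of `x ^ n` in
the coproduct `Y(x) v`, that is, `Δ_{-n-1} v`. -/
structure VertexCoalgebra (F : Type u) (V : Type v) [Field F] [AddCommGroup V] [Module F V] where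
  /-- The coproduct `V → (V ⊗ V)[[x, x⁻¹]]`. -/
  Y : V →ₗ[F] (ℤ → V ⊗[F] V)
  /-- The covacuum map. -/
  c : V →ₗ[F] F
  /-- `(c ⊗ Id) Y(x) v = v`. -/
  counit : ∀ (v : V) (n : ℤ),
    TensorProduct.lid F V (c.rTensor V (Y v n)) = if n = 0 then v else 0
  /-- `(Id ⊗ c) Y(x) v ∈ V[[x]]`. -/
  cocreation : ∀ (v : V), ∀ n < 0, TensorProduct.rid F V (c.lTensor V (Y v n)) = 0
  /-- `lim_{x → 0} (Id ⊗ c) Y(x) v = v`. -/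
  cocreation_zero : ∀ v : V, TensorProduct.rid F V (c.lTensor V (Y v 0)) = v
  /-- `Y(x) v ∈ (V ⊗ V)((x⁻¹))`. -/
  truncation : ∀ v : V, ∃ N : ℤ, ∀ n > N, Y v n = 0
  /-- The Jacobi identity: equality of the coefficients of `x₀ ^ a * x₁ ^ b * x₂ ^ c'` in
  `x₀⁻¹ δ((x₁ - x₂) / x₀) (Id ⊗ Y(x₂)) Y(x₁) v
    - x₀⁻¹ δ((x₂ - x₁) / (-x₀)) (T ⊗ Id) (Id ⊗ Y(x₁)) Y(x₂) v`
  and `x₂⁻¹ δ((x₁ - x₀) / x₂) (Y(x₀) ⊗ Id) Y(x₂) v`, in `V ⊗ (V ⊗ V)`. The map `leftComm` is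
  `T ⊗ Id`. The sums have finite support by truncation. -/
  jacobi : ∀ (v : V) (a b c' : ℤ),
    (∑ᶠ p : ℤ × ℤ, deltaCoeff a p.1 p.2 •
        LinearMap.lTensor V (LinearMap.proj (c' - p.2) ∘ₗ Y) (Y v (b - p.1)))
      - (∑ᶠ p : ℤ × ℤ, deltaCoeffNeg a p.2 p.1 •
        TensorProduct.leftComm F V V V
          (LinearMap.lTensor V (LinearMap.proj (b - p.1) ∘ₗ Y) (Y v (c' - p.2))))
      = ∑ᶠ p : ℤ × ℤ, deltaCoeff p.2 b p.1 •
        TensorProduct.assoc F V V V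
          (LinearMap.rTensor V (LinearMap.proj (a - p.1) ∘ₗ Y) (Y v (c' - p.2)))

/-! ### Graded vector spaces and graded duals -/

/-- The category of `ℤ`-graded vector spaces and degree-preserving linear maps. -/
abbrev GrVect (F : Type u) [Field F] := GradedObject ℤ (ModuleCat.{v} F)

/-- The vector space `∐ k, V_(k)` underlying a graded vector space. -/
abbrev GrVect.Total {F : Type u} [Field F] (V : GrVect.{u, v} F) : Type v := ⨁ k, V k

/-- The linear map on total spaces given by a degree-preserving map. -/
abbrev GrVect.total {F : Type u} [Field F] {V W : GrVect.{u, v} F} (f : V ⟶ W) :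
    V.Total →ₗ[F] W.Total :=
  DirectSum.lmap fun k => (f k).hom

/-- The homogeneous subspace `V_(k)` of `∐ k, V_(k)`. -/
def GrVect.weight {F : Type u} [Field F] (V : GrVect.{u, v} F) (k : ℤ) : Submodule F V.Total :=
  LinearMap.range (DirectSum.lof F ℤ (fun k => V k) k)

/-- The homogeneous subspace `(V ⊗ V)_(k) = ∐_{i + j = k} V_(i) ⊗ V_(j)` of `V ⊗ V`. -/
def GrVect.tensorWeight {F : Type u} [Field F] (V : GrVect.{u, v} F) (k : ℤ) :
    Submodule F (V.Total ⊗[F] V.Total) :=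
  ⨆ i : ℤ, LinearMap.range (TensorProduct.map
    (DirectSum.lof F ℤ (fun k => V k) i) (DirectSum.lof F ℤ (fun k => V k) (k - i)))

/-- `V_(k) = 0` for `k` sufficiently small. -/
def GrVect.BoundedBelow {F : Type u} [Field F] (V : GrVect.{u, v} F) : Prop :=
  ∃ N : ℤ, ∀ k < N, Subsingleton (V k)

/-- The contravariant graded dual functor, `V' = ∐ k, Hom(V_(k), F)`, acting on morphisms by
transposition. -/
def gradedDual (F : Type u) [Field F] :
    (GrVect.{u, max u v} F)ᵒᵖ ⥤ GrVect.{u, max u v} F where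
  obj V := fun k => ModuleCat.of F (Module.Dual F (V.unop k))
  map f := fun k => ModuleCat.ofHom (f.unop k).hom.dualMap

/-- The canonical map `V ⟶ V''`, sending `v` to evaluation at `v`. -/
def toDoubleDual {F : Type u} [Field F] (V : GrVect.{u, max u v} F) :
    V ⟶ (gradedDual.{u, v} F).obj (op ((gradedDual.{u, v} F).obj (op V))) :=
  fun k => ModuleCat.ofHom (Module.Dual.eval F (V k))

/-- The natural pairing `⟨f, v⟩ = ∑ k, f_k (v_k)` of `V'` with `V`. -/
def pairing {F : Type u} [Field F] (V : GrVect.{u, max u v} F) :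
    ((gradedDual.{u, v} F).obj (op V)).Total →ₗ[F] Module.Dual F V.Total :=
  DirectSum.toModule F ℤ (Module.Dual F V.Total)
    fun k => (DirectSum.component F ℤ (fun k => V k) k).dualMap

/-- The natural pairing of `V' ⊗ V'` with `V ⊗ V`, `⟨f ⊗ g, v ⊗ w⟩ = ⟨f, v⟩ ⟨g, w⟩`. -/
def tensorPairing {F : Type u} [Field F] (V : GrVect.{u, max u v} F) :
    ((gradedDual.{u, v} F).obj (op V)).Total ⊗[F] ((gradedDual.{u, v} F).obj (op V)).Total
      →ₗ[F] Module.Dual F (V.Total ⊗[F] V.Total) :=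
  TensorProduct.dualDistrib F V.Total V.Total ∘ₗ TensorProduct.map (pairing V) (pairing V)

/-! ### The category of finite-dimensionally graded vertex algebras -/

/-- A finite-dimensionally graded vertex algebra. -/
structure FDGVertexAlgebra (F : Type u) [Field F] where
  /-- The underlying graded vector space. -/
  space : GrVect.{u, v} F
  /-- The vertex algebra structure on `∐ k, V_(k)`. -/
  str : VertexAlgebra F space.Total
  boundedBelow : space.BoundedBelow
  finite : ∀ k, FiniteDimensional F (space k)
  /-- `u_n w ∈ V_(j+k-n-1)` for `u ∈ V_(j)`, `w ∈ V_(k)`; the mode `u_n` is the coefficient of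
  `x ^ (-n-1)`. -/
  graded : ∀ (j k n : ℤ), ∀ u ∈ space.weight j, ∀ w ∈ space.weight k,
    str.Y u (-n - 1) w ∈ space.weight (j + k - n - 1)

/-- A morphism of graded vertex algebras: a degree-preserving linear map with
`f (Y(u, x) w) = Y(f u, x) (f w)` and `f 𝟏 = 𝟏`. -/
@[ext]
structure FDGVertexAlgebra.Hom {F : Type u} [Field F] (A B : FDGVertexAlgebra.{u, v} F) where
  /-- The underlying map of graded vector spaces. -/
  map : A.space ⟶ B.space
  map_Y : ∀ (u w : A.space.Total) (n : ℤ),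
    GrVect.total map (A.str.Y u n w)
      = B.str.Y (GrVect.total map u) n (GrVect.total map w)
  map_vac : GrVect.total map A.str.vac = B.str.vac

theorem GrVect.total_id {F : Type u} [Field F] (V : GrVect.{u, v} F) :
    GrVect.total (𝟙 V) = LinearMap.id := by
  ext k x : 2
  simp [GrVect.total]

theorem GrVect.total_comp {F : Type u} [Field F] {U V W : GrVect.{u, v} F}
    (f : U ⟶ V) (g : V ⟶ W) :
    GrVect.total (f ≫ g) = GrVect.total g ∘ₗ GrVect.total f := by
  ext k x : 2
  simp [GrVect.total, DirectSum.lmap_lof]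

instance FDGVertexAlgebra.category (F : Type u) [Field F] :
    Category (FDGVertexAlgebra.{u, v} F) where
  Hom := FDGVertexAlgebra.Hom
  id A :=
    { map := 𝟙 A.space
      map_Y := by simp [GrVect.total_id]
      map_vac := by simp [GrVect.total_id] }
  comp f g :=
    { map := f.map ≫ g.map
      map_Y := by simp [GrVect.total_comp, f.map_Y, g.map_Y]
      map_vac := by simp [GrVect.total_comp, f.map_vac, g.map_vac] }
  id_comp f := FDGVertexAlgebra.Hom.ext (Category.id_comp f.map)
  comp_id f := FDGVertexAlgebra.Hom.ext (Category.comp_id f.map)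
  assoc f g h := FDGVertexAlgebra.Hom.ext (Category.assoc f.map g.map h.map)

/-- The functor from graded vertex algebras to graded vector spaces. -/
def FDGVertexAlgebra.forget (F : Type u) [Field F] :
    FDGVertexAlgebra.{u, v} F ⥤ GrVect.{u, v} F where
  obj A := A.space
  map f := FDGVertexAlgebra.Hom.map f

/-! ### The category of finite-dimensionally graded vertex coalgebras -/

/-- A finite-dimensionally graded vertex coalgebra. -/
structure FDGVertexCoalgebra (F : Type u) [Field F] where
  /-- The underlying graded vector space. -/
  space : GrVect.{u, v} F
  /-- The vertex coalgebra structure on `∐ k, V_(k)`. -/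
  str : VertexCoalgebra F space.Total
  boundedBelow : space.BoundedBelow
  finite : ∀ k, FiniteDimensional F (space k)
  /-- `Δ_k w ∈ (V ⊗ V)_(r+k+1)` for `w ∈ V_(r)`; `Δ_k` is the coefficient of `x ^ (-k-1)`. -/
  graded : ∀ (r k : ℤ), ∀ w ∈ space.weight r,
    str.Y w (-k - 1) ∈ space.tensorWeight (r + k + 1)

/-- A morphism of graded vertex coalgebras: a degree-preserving linear map with
`(f ⊗ f) Y(x) w = Y(x) (f w)` and `c ∘ f = c`. -/
@[ext]
structure FDGVertexCoalgebra.Hom {F : Type u} [Field F] (C D : FDGVertexCoalgebra.{u, v} F) where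
  /-- The underlying map of graded vector spaces. -/
  map : C.space ⟶ D.space
  map_Y : ∀ (w : C.space.Total) (n : ℤ),
    TensorProduct.map (GrVect.total map) (GrVect.total map) (C.str.Y w n)
      = D.str.Y (GrVect.total map w) n
  map_c : ∀ w : C.space.Total, D.str.c (GrVect.total map w) = C.str.c w

instance FDGVertexCoalgebra.category (F : Type u) [Field F] :
    Category (FDGVertexCoalgebra.{u, v} F) where
  Hom := FDGVertexCoalgebra.Hom
  id C :=
    { map := 𝟙 C.space
      map_Y := by simp [GrVect.total_id]
      map_c := by simp [GrVect.total_id] }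
  comp f g :=
    { map := f.map ≫ g.map
      map_Y := by
        intro w n
        simp only [GrVect.total_comp, TensorProduct.map_comp, LinearMap.comp_apply, f.map_Y,
          g.map_Y]
      map_c := by simp [GrVect.total_comp, f.map_c, g.map_c] }
  id_comp f := FDGVertexCoalgebra.Hom.ext (Category.id_comp f.map)
  comp_id f := FDGVertexCoalgebra.Hom.ext (Category.comp_id f.map)
  assoc f g h := FDGVertexCoalgebra.Hom.ext (Category.assoc f.map g.map h.map)

/-- The functor from graded vertex coalgebras to graded vector spaces. -/
def FDGVertexCoalgebra.forget (F : Type u) [Field F] :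
    FDGVertexCoalgebra.{u, v} F ⥤ GrVect.{u, v} F where
  obj C := C.space
  map f := FDGVertexCoalgebra.Hom.map f

/-! ### Dual structures -/

/-- Under an identification `φ` of the graded space of `C` with the graded dual of that of `A`, the
coalgebra structure of `C` is the dual of the algebra structure of `A`:
`⟨Y(x) ξ, v ⊗ w⟩ = ⟨ξ, Y(v, x) w⟩` and `c(ξ) = ⟨ξ, 𝟏⟩`. -/
structure IsDualCoalgebra {F : Type u} [Field F] (A : FDGVertexAlgebra.{u, max u v} F)
    (C : FDGVertexCoalgebra.{u, max u v} F)
    (φ : C.space ≅ (gradedDual.{u, v} F).obj (op A.space)) : Prop where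
  coproduct : ∀ (ξ : C.space.Total) (v w : A.space.Total) (n : ℤ),
    tensorPairing A.space
        (TensorProduct.map (GrVect.total φ.hom) (GrVect.total φ.hom) (C.str.Y ξ n)) (v ⊗ₜ[F] w)
      = pairing A.space (GrVect.total φ.hom ξ) (A.str.Y v n w)
  covacuum : ∀ ξ : C.space.Total, C.str.c ξ = pairing A.space (GrVect.total φ.hom ξ) A.str.vac

/-- Under an identification `ψ` of the graded space of `A` with the graded dual of that of `C`, the
algebra structure of `A` is the dual of the coalgebra structure of `C`:
`⟨Y(f, x) g, w⟩ = ⟨f ⊗ g, Y(x) w⟩` and `⟨𝟏, w⟩ = c(w)`. -/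
structure IsDualAlgebra {F : Type u} [Field F] (C : FDGVertexCoalgebra.{u, max u v} F)
    (A : FDGVertexAlgebra.{u, max u v} F)
    (ψ : A.space ≅ (gradedDual.{u, v} F).obj (op C.space)) : Prop where
  product : ∀ (f g : A.space.Total) (w : C.space.Total) (n : ℤ),
    pairing C.space (GrVect.total ψ.hom (A.str.Y f n g)) w
      = tensorPairing C.space (GrVect.total ψ.hom f ⊗ₜ[F] GrVect.total ψ.hom g) (C.str.Y w n)
  vacuum : ∀ w : C.space.Total, pairing C.space (GrVect.total ψ.hom A.str.vac) w = C.str.c w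

end

end VertexDuality

open VertexDuality

namespace VertexDuality

noncomputable section

/-! Everything is read off from the pairing of the graded dual `V'` with `V`. It embeds `V'` in
`V*`, and over a field tensor products of injective pairings are again injective, so `V' ⊗ V'` and
`V' ⊗ (V' ⊗ V')` embed in the duals of the tensor square and cube of `V`. An identity between such
elements can therefore be tested on pure tensors. There the axioms of a vertex coalgebra and of a
vertex algebra are transposes of each other, the Jacobi identities included
(`pairingCube_cojacobiator`). These comparisons are proved for an abstract pairing `B`, so that one
lemma serves algebras (with `B` the pairing) and coalgebras (with `B` the flipped pairing).

What needs an argument is that the transposed operations land in the graded dual rather than in the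
full dual. The grading makes each mode homogeneous, so the transpose of a homogeneous functional is
concentrated in one degree. On `V` such a functional lies in `V'` (`exists_pairing_eq`). On `V ⊗ V`
it comes from `V' ⊗ V'` because boundedness below leaves finitely many pairs of degrees, and finite
dimension gives `(V_i ⊗ V_j)* = V_i* ⊗ V_j*` (`exists_tensorPairing_eq`). The covacuum must also be
concentrated in one degree; this is not an axiom but follows from the counit and cocreation
properties (`FDGVertexCoalgebra.c_incl_of_ne`). Truncation on the dual side comes from the lower
bound on degrees.

Finally, evaluation `V → V''` is bijective in each degree by finite dimension and respects the
structures by the defining adjunctions. Its naturality and the triangle identity hold by definition.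
-/

/-! ### Pairings of tensor powers -/

section Pairing

variable {F : Type*} [Field F] {P P' Q Q' : Type*} [AddCommGroup P] [Module F P]
  [AddCommGroup P'] [Module F P'] [AddCommGroup Q] [Module F Q] [AddCommGroup Q'] [Module F Q']

/-- The tensor product of two nondegenerate pairings is nondegenerate. -/
theorem dualDistrib_comp_map_injective {B : P →ₗ[F] Module.Dual F Q}
    {B' : P' →ₗ[F] Module.Dual F Q'} (hB : Function.Injective B) (hB' : Function.Injective B') :
    Function.Injective (TensorProduct.dualDistrib F Q Q' ∘ₗ TensorProduct.map B B') := by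
  classical
  rw [injective_iff_map_eq_zero]
  intro X hX
  -- Contracting the first factor with `q` leaves a vector of `P'` that `B'` kills, so injectivity
  -- of `B'` applies.
  have h₁ : ∀ q, TensorProduct.lid F P' ((B.flip q).rTensor P' X) = 0 := by
    intro q
    apply hB'
    ext q'
    rw [map_zero, LinearMap.zero_apply, ← LinearMap.zero_apply (σ₁₂ := RingHom.id F) (q ⊗ₜ[F] q'),
      ← hX]
    clear hX
    induction X with
    | zero => simp
    | tmul x y => simp
    | add x y hx hy => simp only [map_add, LinearMap.add_apply, hx, hy]
  -- Write `X = ∑ p_i ⊗ b_i`. Then `B p_i q` is the `i`-th coordinate of the contraction, which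
  -- vanishes for all `q`, and injectivity of `B` gives `p_i = 0`.
  let b := Module.Basis.ofVectorSpace F P'
  apply (TensorProduct.equivFinsuppOfBasisRight (M := P) b).injective
  ext i
  rw [TensorProduct.equivFinsuppOfBasisRight_apply, map_zero, Finsupp.zero_apply]
  apply hB
  ext q
  rw [map_zero, LinearMap.zero_apply, ← map_zero (b.coord i), ← h₁ q]
  clear hX h₁
  induction X with
  | zero => simp
  | tmul x y => simp [mul_comm]
  | add x y hx hy => simp only [map_add, LinearMap.add_apply, hx, hy]

/-- The pairing of tensor squares induced by a pairing. -/
def pairingSq (B : P →ₗ[F] Module.Dual F Q) : P ⊗[F] P →ₗ[F] Module.Dual F (Q ⊗[F] Q) :=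
  TensorProduct.dualDistrib F Q Q ∘ₗ TensorProduct.map B B

/-- The pairing of tensor cubes induced by a pairing. -/
def pairingCube (B : P →ₗ[F] Module.Dual F Q) :
    P ⊗[F] (P ⊗[F] P) →ₗ[F] Module.Dual F (Q ⊗[F] (Q ⊗[F] Q)) :=
  TensorProduct.dualDistrib F Q (Q ⊗[F] Q) ∘ₗ TensorProduct.map B (pairingSq B)

@[simp]
theorem pairingSq_tmul (B : P →ₗ[F] Module.Dual F Q) (p p' : P) (q q' : Q) :
    pairingSq B (p ⊗ₜ p') (q ⊗ₜ q') = B p q * B p' q' := rfl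

@[simp]
theorem pairingCube_tmul (B : P →ₗ[F] Module.Dual F Q) (p : P) (X : P ⊗[F] P) (q : Q)
    (Z : Q ⊗[F] Q) : pairingCube B (p ⊗ₜ X) (q ⊗ₜ Z) = B p q * pairingSq B X Z := rfl

theorem pairingSq_injective {B : P →ₗ[F] Module.Dual F Q} (hB : Function.Injective B) :
    Function.Injective (pairingSq B) :=
  dualDistrib_comp_map_injective hB hB

theorem pairingCube_injective {B : P →ₗ[F] Module.Dual F Q} (hB : Function.Injective B) :
    Function.Injective (pairingCube B) :=
  dualDistrib_comp_map_injective hB (pairingSq_injective hB)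

theorem pairingSq_flip (B : P →ₗ[F] Module.Dual F Q) (X : P ⊗[F] P) (Z : Q ⊗[F] Q) :
    pairingSq B.flip Z X = pairingSq B X Z := by
  induction X with
  | zero => simp
  | add x y hx hy => simp only [map_add, LinearMap.add_apply, hx, hy]
  | tmul p p' =>
    induction Z with
    | zero => simp
    | add x y hx hy => simp only [map_add, LinearMap.add_apply, hx, hy]
    | tmul q q' => simp

/-- Pairings transform along adjoint maps. -/
theorem pairingSq_map {B : P →ₗ[F] Module.Dual F Q} {B' : P' →ₗ[F] Module.Dual F Q'}
    {f : P →ₗ[F] P'} {g : Q' →ₗ[F] Q} (h : ∀ p q, B' (f p) q = B p (g q))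
    (X : P ⊗[F] P) (Z : Q' ⊗[F] Q') :
    pairingSq B' (TensorProduct.map f f X) Z = pairingSq B X (TensorProduct.map g g Z) := by
  induction X with
  | zero => simp
  | add x y hx hy => simp only [map_add, LinearMap.add_apply, hx, hy]
  | tmul p p' =>
    induction Z with
    | zero => simp
    | add x y hx hy => simp only [map_add, hx, hy]
    | tmul q q' => simp [h]

/-- When `e` represents `c`, contraction by `c` is transposed to insertion of `e`. This exchanges
the counit axiom with the vacuum axiom, and the next lemma does the same for creation. -/
theorem pairing_lid_rTensor {B : P →ₗ[F] Module.Dual F Q} {c : P →ₗ[F] F} {e : Q}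
    (hc : ∀ p, c p = B p e) (X : P ⊗[F] P) (q : Q) :
    B (TensorProduct.lid F P (c.rTensor P X)) q = pairingSq B X (e ⊗ₜ q) := by
  induction X with
  | zero => simp
  | add x y hx hy => simp only [map_add, LinearMap.add_apply, hx, hy]
  | tmul p p' => simp [hc]

theorem pairing_rid_lTensor {B : P →ₗ[F] Module.Dual F Q} {c : P →ₗ[F] F} {e : Q}
    (hc : ∀ p, c p = B p e) (X : P ⊗[F] P) (q : Q) :
    B (TensorProduct.rid F P (c.lTensor P X)) q = pairingSq B X (q ⊗ₜ e) := by
  induction X with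
  | zero => simp
  | add x y hx hy => simp only [map_add, LinearMap.add_apply, hx, hy]
  | tmul p p' => simp [hc, mul_comm]

end Pairing

/-! ### The Jacobi identity under a pairing -/

section Jacobi

variable {F : Type*} [Field F] {P Q : Type*} [AddCommGroup P] [Module F P]
  [AddCommGroup Q] [Module F Q]

/-- The difference of the two sides of the Jacobi identity of a vertex algebra. -/
def jacobiator (Y : Q →ₗ[F] (ℤ → Module.End F Q)) (u v w : Q) (a b c : ℤ) : Q :=
  (∑ᶠ p : ℤ × ℤ, deltaCoeff a p.1 p.2 • Y u (b - p.1) (Y v (c - p.2) w))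
    - (∑ᶠ p : ℤ × ℤ, deltaCoeffNeg a p.2 p.1 • Y v (c - p.2) (Y u (b - p.1) w))
    - ∑ᶠ p : ℤ × ℤ, deltaCoeff p.2 b p.1 • Y (Y u (a - p.1) v) (c - p.2) w

/-- The difference of the two sides of the Jacobi identity of a vertex coalgebra. -/
def cojacobiator (Y : P →ₗ[F] (ℤ → P ⊗[F] P)) (v : P) (a b c : ℤ) : P ⊗[F] (P ⊗[F] P) :=
  (∑ᶠ p : ℤ × ℤ, deltaCoeff a p.1 p.2 •
      LinearMap.lTensor P (LinearMap.proj (c - p.2) ∘ₗ Y) (Y v (b - p.1)))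
    - (∑ᶠ p : ℤ × ℤ, deltaCoeffNeg a p.2 p.1 •
      TensorProduct.leftComm F P P P
        (LinearMap.lTensor P (LinearMap.proj (b - p.1) ∘ₗ Y) (Y v (c - p.2))))
    - ∑ᶠ p : ℤ × ℤ, deltaCoeff p.2 b p.1 •
      TensorProduct.assoc F P P P
        (LinearMap.rTensor P (LinearMap.proj (a - p.1) ∘ₗ Y) (Y v (c - p.2)))

/-- The delta coefficients live on the ray `(-1 - a - k, k)` with `k ≥ 0`, so vanishing of `G` far
along the ray suffices. -/
theorem deltaCoeff_support_finite {M : Type*} [AddCommGroup M] (a : ℤ) (G : ℤ × ℤ → M) (N : ℤ)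
    (h : ∀ k > N, G (-1 - a - k, k) = 0) :
    (Function.support fun p : ℤ × ℤ => deltaCoeff a p.1 p.2 • G p).Finite := by
  refine ((Set.finite_Icc 0 N).image fun k => (-1 - a - k, k)).subset ?_
  rintro ⟨x, y⟩ hp
  have hd : deltaCoeff a x y ≠ 0 := fun h0 => hp (by simp [h0])
  have hG : G (x, y) ≠ 0 := fun h0 => hp (by simp [h0])
  simp only [deltaCoeff, ne_eq, ite_eq_right_iff, not_forall] at hd
  obtain ⟨⟨hy, hs⟩, -⟩ := hd
  obtain rfl : x = -1 - a - y := by omega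
  exact ⟨y, ⟨hy, not_lt.1 fun hlt => hG (h y hlt)⟩, rfl⟩

theorem deltaCoeffNeg_support_finite {M : Type*} [AddCommGroup M] (a : ℤ) (G : ℤ × ℤ → M) (N : ℤ)
    (h : ∀ k > N, G (k, -1 - a - k) = 0) :
    (Function.support fun p : ℤ × ℤ => deltaCoeffNeg a p.2 p.1 • G p).Finite := by
  refine ((deltaCoeff_support_finite a (fun p => G p.swap) N h).image Prod.swap).subset ?_
  rintro ⟨x, y⟩ hp
  refine ⟨(y, x), fun h0 => hp ?_, rfl⟩
  simp only [Prod.swap_prod_mk] at h0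
  simp [deltaCoeffNeg, mul_smul, h0]

theorem deltaCoeff_support_finite' {M : Type*} [AddCommGroup M] (b : ℤ) (G : ℤ × ℤ → M) (N : ℤ)
    (h : ∀ k > N, G (k, -1 - b - k) = 0) :
    (Function.support fun p : ℤ × ℤ => deltaCoeff p.2 b p.1 • G p).Finite := by
  refine ((Set.finite_Icc 0 N).image fun k => (k, -1 - b - k)).subset ?_
  rintro ⟨x, y⟩ hp
  have hd : deltaCoeff y b x ≠ 0 := fun h0 => hp (by simp [h0])
  have hG : G (x, y) ≠ 0 := fun h0 => hp (by simp [h0])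
  simp only [deltaCoeff, ne_eq, ite_eq_right_iff, not_forall] at hd
  obtain ⟨⟨hy, hs⟩, -⟩ := hd
  obtain rfl : y = -1 - b - x := by omega
  exact ⟨x, ⟨hy, not_lt.1 fun hlt => hG (h x hlt)⟩, rfl⟩

variable {B : P →ₗ[F] Module.Dual F Q} {D : P →ₗ[F] (ℤ → P ⊗[F] P)}
  {Y : Q →ₗ[F] (ℤ → Module.End F Q)}

/-- Transposition reverses composition: the coproduct applied last becomes the product applied
first. -/
theorem pairingCube_lTensor
    (h : ∀ p q q' n, pairingSq B (D p n) (q ⊗ₜ q') = B p (Y q n q')) (m : ℤ) (X : P ⊗[F] P)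
    (u v w : Q) :
    pairingCube B (LinearMap.lTensor P (LinearMap.proj m ∘ₗ D) X) (u ⊗ₜ (v ⊗ₜ w))
      = pairingSq B X (u ⊗ₜ Y v m w) := by
  induction X with
  | zero => simp
  | add x y hx hy => simp only [map_add, LinearMap.add_apply, hx, hy]
  | tmul p p' => simp [h]

theorem pairingCube_leftComm (X : P ⊗[F] (P ⊗[F] P)) (u v w : Q) :
    pairingCube B (TensorProduct.leftComm F P P P X) (u ⊗ₜ (v ⊗ₜ w))
      = pairingCube B X (v ⊗ₜ (u ⊗ₜ w)) := by
  induction X with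
  | zero => simp
  | add x y hx hy => simp only [map_add, LinearMap.add_apply, hx, hy]
  | tmul p X =>
    induction X with
    | zero => simp
    | add x y hx hy => simp only [map_add, tmul_add, LinearMap.add_apply, hx, hy]
    | tmul p' p'' => simp [mul_left_comm]

theorem pairingCube_assoc (X : P ⊗[F] P) (p : P) (u v w : Q) :
    pairingCube B (TensorProduct.assoc F P P P (X ⊗ₜ p)) (u ⊗ₜ (v ⊗ₜ w))
      = pairingSq B X (u ⊗ₜ v) * B p w := by
  induction X with
  | zero => simp
  | add x y hx hy => simp only [map_add, add_tmul, LinearMap.add_apply, hx, hy, add_mul]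
  | tmul p' p'' => simp [mul_assoc]

theorem pairingCube_rTensor
    (h : ∀ p q q' n, pairingSq B (D p n) (q ⊗ₜ q') = B p (Y q n q')) (m : ℤ) (X : P ⊗[F] P)
    (u v w : Q) :
    pairingCube B (TensorProduct.assoc F P P P
        (LinearMap.rTensor P (LinearMap.proj m ∘ₗ D) X)) (u ⊗ₜ (v ⊗ₜ w))
      = pairingSq B X (Y u m v ⊗ₜ w) := by
  induction X with
  | zero => simp
  | add x y hx hy => simp only [map_add, LinearMap.add_apply, hx, hy]
  | tmul p p' => simp [h, pairingCube_assoc]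

/-- For adjoint operations, the two Jacobi identities correspond under the pairing. -/
theorem pairingCube_cojacobiator
    (h : ∀ p q q' n, pairingSq B (D p n) (q ⊗ₜ q') = B p (Y q n q'))
    (hD : ∀ p, ∃ N : ℤ, ∀ n > N, D p n = 0) (hY : ∀ u v, ∃ N : ℤ, ∀ n < N, Y u n v = 0)
    (p : P) (u v w : Q) (a b c : ℤ) :
    pairingCube B (cojacobiator D p a b c) (u ⊗ₜ (v ⊗ₜ w)) = B p (jacobiator Y u v w a b c) := by
  obtain ⟨N, hN⟩ := hD p
  obtain ⟨N₁, hN₁⟩ := hY v w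
  obtain ⟨N₂, hN₂⟩ := hY u w
  obtain ⟨N₃, hN₃⟩ := hY u v
  let L : P ⊗[F] (P ⊗[F] P) →+ F :=
    ((pairingCube B).flip (u ⊗ₜ (v ⊗ₜ w))).toAddMonoidHom
  have hL : ∀ X, pairingCube B X (u ⊗ₜ (v ⊗ₜ w)) = L X := fun X => rfl
  have hR : ∀ q, B p q = (B p).toAddMonoidHom q := fun q => rfl
  rw [hL, hR]
  simp only [cojacobiator, jacobiator, map_sub]
  rw [L.map_finsum, L.map_finsum, L.map_finsum, AddMonoidHom.map_finsum,
    AddMonoidHom.map_finsum, AddMonoidHom.map_finsum]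
  · simp only [map_zsmul, ← hL, ← hR, LinearMap.smul_apply, pairingCube_leftComm, pairingCube_lTensor h,
      pairingCube_rTensor h, h]
  -- On the algebra side the inner product vanishes, since its exponent tends to `-∞` along the ray;
  -- each sum has its own pair of vectors and its own bound.
  · exact deltaCoeff_support_finite' b _ (a - N₃) fun k hk => by
      simp [hN₃ (a - k) (by omega)]
  · exact deltaCoeffNeg_support_finite a _ (b - N₂) fun k hk => by
      simp [hN₂ (b - k) (by omega)]
  · exact deltaCoeff_support_finite a _ (c - N₁) fun k hk => by
      simp [hN₁ (c - k) (by omega)]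
  -- On the coalgebra side it is the coproduct applied first, to `p`, whose exponent tends to `+∞`;
  -- the same `N` serves all three sums.
  · exact deltaCoeff_support_finite' b _ (N - c - 1 - b) fun k hk => by
      simp [hN (c - (-1 - b - k)) (by omega)]
  · exact deltaCoeffNeg_support_finite a _ (N - c - 1 - a) fun k hk => by
      simp [hN (c - (-1 - a - k)) (by omega)]
  · exact deltaCoeff_support_finite a _ (N - b - 1 - a) fun k hk => by
      simp [hN (b - (-1 - a - k)) (by omega)]

theorem jacobiator_eq_zero_iff (Y : Q →ₗ[F] (ℤ → Module.End F Q)) (u v w : Q) (a b c : ℤ) :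
    jacobiator Y u v w a b c = 0 ↔
    (∑ᶠ p : ℤ × ℤ, deltaCoeff a p.1 p.2 • Y u (b - p.1) (Y v (c - p.2) w))
      - (∑ᶠ p : ℤ × ℤ, deltaCoeffNeg a p.2 p.1 • Y v (c - p.2) (Y u (b - p.1) w))
      = ∑ᶠ p : ℤ × ℤ, deltaCoeff p.2 b p.1 • Y (Y u (a - p.1) v) (c - p.2) w :=
  sub_eq_zero

theorem cojacobiator_eq_zero_iff (Y : P →ₗ[F] (ℤ → P ⊗[F] P)) (v : P) (a b c : ℤ) :
    cojacobiator Y v a b c = 0 ↔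
    (∑ᶠ p : ℤ × ℤ, deltaCoeff a p.1 p.2 •
        LinearMap.lTensor P (LinearMap.proj (c - p.2) ∘ₗ Y) (Y v (b - p.1)))
      - (∑ᶠ p : ℤ × ℤ, deltaCoeffNeg a p.2 p.1 •
        TensorProduct.leftComm F P P P
          (LinearMap.lTensor P (LinearMap.proj (b - p.1) ∘ₗ Y) (Y v (c - p.2))))
      = ∑ᶠ p : ℤ × ℤ, deltaCoeff p.2 b p.1 •
        TensorProduct.assoc F P P P
          (LinearMap.rTensor P (LinearMap.proj (a - p.1) ∘ₗ Y) (Y v (c - p.2))) :=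
  sub_eq_zero

end Jacobi

/-! ### Graded duals -/

section GradedDual

variable {F : Type u} [Field F]

/-- The graded dual of a graded vector space. -/
abbrev GrVect.dual (V : GrVect.{u, max u v} F) : GrVect.{u, max u v} F :=
  (gradedDual.{u, v} F).obj (op V)

/-- The inclusion of the homogeneous subspace `V_(k)`. -/
abbrev GrVect.incl (V : GrVect.{u, v} F) (k : ℤ) : V k →ₗ[F] V.Total :=
  DirectSum.lof F ℤ (fun k => V k) k

/-- The inclusion of a functional on `V_(k)` into the graded dual. -/
abbrev GrVect.dualIncl (V : GrVect.{u, max u v} F) (k : ℤ) :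
    Module.Dual F (V k) →ₗ[F] (GrVect.dual.{u, v} V).Total :=
  DirectSum.lof F ℤ (fun k => (GrVect.dual.{u, v} V) k) k

theorem GrVect.induction_on {V : GrVect.{u, v} F} {motive : V.Total → Prop} (x : V.Total)
    (zero : motive 0) (incl : ∀ k x, motive (V.incl k x))
    (add : ∀ x y, motive x → motive y → motive (x + y)) : motive x :=
  DirectSum.induction_on x zero incl add

theorem GrVect.incl_mem_weight (V : GrVect.{u, v} F) (k : ℤ) (x : V k) :
    V.incl k x ∈ V.weight k := ⟨x, rfl⟩

theorem GrVect.incl_apply_of_ne (V : GrVect.{u, v} F) {j k : ℤ} (h : j ≠ k) (x : V j) :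
    V.incl j x k = 0 := DirectSum.of_eq_of_ne _ _ _ h.symm

theorem GrVect.weight_eq_bot {V : GrVect.{u, v} F} {k : ℤ} (h : Subsingleton (V k)) :
    V.weight k = ⊥ := by
  rw [eq_bot_iff]
  rintro _ ⟨x, rfl⟩
  simp [Subsingleton.elim x 0]

theorem GrVect.tensorWeight_eq_bot {V : GrVect.{u, v} F} {N k : ℤ}
    (h : ∀ k < N, Subsingleton (V k)) (hk : k < 2 * N) : V.tensorWeight k = ⊥ := by
  rw [eq_bot_iff]
  refine iSup_le fun i => ?_
  rintro _ ⟨X, rfl⟩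
  rw [Submodule.mem_bot]
  induction X with
  | zero => simp
  | add x y hx hy => simp only [map_add, hx, hy, add_zero]
  | tmul x y =>
    -- As `k < 2 * N`, the degrees `i` and `k - i` cannot both be at least `N`.
    rcases lt_or_ge i N with hi | hi
    · have := h i hi
      simp [Subsingleton.elim x 0]
    · have := h (k - i) (by omega)
      simp [Subsingleton.elim y 0]

theorem GrVect.BoundedBelow.dual {V : GrVect.{u, max u v} F} (h : V.BoundedBelow) :
    (GrVect.dual.{u, v} V).BoundedBelow := by
  obtain ⟨N, hN⟩ := h
  refine ⟨N, fun k hk => ?_⟩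
  have := hN k hk
  exact inferInstanceAs (Subsingleton (Module.Dual F (V k)))

theorem GrVect.finite_dual {V : GrVect.{u, max u v} F} (h : ∀ k, FiniteDimensional F (V k))
    (k : ℤ) : FiniteDimensional F (GrVect.dual.{u, v} V k) :=
  have := h k
  inferInstanceAs (FiniteDimensional F (Module.Dual F (V k)))

variable (V : GrVect.{u, max u v} F)

theorem tensorPairing_eq_pairingSq : tensorPairing.{u, v} V = pairingSq (pairing.{u, v} V) := rfl

theorem pairing_dualIncl (k : ℤ) (f : Module.Dual F (V k)) (x : V.Total) :
    pairing.{u, v} V (GrVect.dualIncl.{u, v} V k f) x = f (x k) :=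
  LinearMap.congr_fun (DirectSum.toModule_lof (M := fun k => (GrVect.dual.{u, v} V) k) F
    (φ := fun k => (DirectSum.component F ℤ (fun k => V k) k).dualMap) k f) x

theorem pairing_dualIncl_incl (k : ℤ) (f : Module.Dual F (V k)) (x : V k) :
    pairing.{u, v} V (GrVect.dualIncl.{u, v} V k f) (V.incl k x) = f x := by
  rw [pairing_dualIncl, DirectSum.lof_apply]

theorem pairing_dualIncl_incl_of_ne {j k : ℤ} (h : j ≠ k) (f : Module.Dual F (V j)) (x : V k) :
    pairing.{u, v} V (GrVect.dualIncl.{u, v} V j f) (V.incl k x) = 0 := by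
  rw [pairing_dualIncl, V.incl_apply_of_ne h.symm, map_zero]

theorem pairing_incl (ξ : (GrVect.dual.{u, v} V).Total) (k : ℤ) (x : V k) :
    pairing.{u, v} V ξ (V.incl k x) = (show Module.Dual F (V k) from ξ k) x := by
  induction ξ using GrVect.induction_on with
  | zero => simp; rfl
  | add x y hx hy => simp only [map_add, LinearMap.add_apply, hx, hy]; rfl
  | incl j f =>
    by_cases h : j = k
    · subst h
      rw [DirectSum.lof_apply]
      exact pairing_dualIncl_incl V j f x
    · rw [GrVect.incl_apply_of_ne _ h]
      exact pairing_dualIncl_incl_of_ne V h f x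

theorem pairing_injective : Function.Injective (pairing.{u, v} V) := by
  rw [injective_iff_map_eq_zero]
  intro ξ h
  refine DFinsupp.ext fun k => ?_
  refine LinearMap.ext (f := (show Module.Dual F (V k) from ξ k)) fun x => ?_
  rw [← pairing_incl, h]
  rfl

theorem tensorPairing_injective : Function.Injective (tensorPairing.{u, v} V) :=
  pairingSq_injective (pairing_injective V)

variable {V}

/-- Degree-preserving maps are adjoint to their transposes. -/
theorem pairing_total_gradedDual_map {W : GrVect.{u, max u v} F} (f : V ⟶ W)
    (ξ : (GrVect.dual.{u, v} W).Total) (x : V.Total) :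
    pairing.{u, v} V (GrVect.total ((gradedDual.{u, v} F).map f.op) ξ) x
      = pairing.{u, v} W ξ (GrVect.total f x) := by
  induction x using GrVect.induction_on with
  | zero => simp
  | add x y hx hy => simp only [map_add, hx, hy]
  | incl k x =>
    rw [pairing_incl, DirectSum.lmap_lof, pairing_incl]
    rfl

theorem pairing_total_toDoubleDual (x : V.Total) (ξ : (GrVect.dual.{u, v} V).Total) :
    pairing.{u, v} (GrVect.dual.{u, v} V) (GrVect.total (toDoubleDual.{u, v} V) x) ξ
      = pairing.{u, v} V ξ x := by
  induction x using GrVect.induction_on with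
  | zero => simp
  | add x y hx hy => simp only [map_add, LinearMap.add_apply, hx, hy]
  | incl k x =>
    rw [pairing_incl, DirectSum.lmap_lof]
    exact pairing_dualIncl _ k _ ξ

theorem tensorPairing_total_toDoubleDual (X : V.Total ⊗[F] V.Total)
    (Z : (GrVect.dual.{u, v} V).Total ⊗[F] (GrVect.dual.{u, v} V).Total) :
    tensorPairing.{u, v} (GrVect.dual.{u, v} V)
        (TensorProduct.map (GrVect.total (toDoubleDual.{u, v} V))
          (GrVect.total (toDoubleDual.{u, v} V)) X) Z
      = tensorPairing.{u, v} V Z X := by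
  rw [tensorPairing_eq_pairingSq, tensorPairing_eq_pairingSq,
    pairingSq_map (B := (pairing.{u, v} V).flip) (g := LinearMap.id) pairing_total_toDoubleDual,
    TensorProduct.map_id, LinearMap.id_apply, pairingSq_flip]

/-- A functional supported in degree `k` is represented by a vector of degree `k`. -/
theorem exists_pairing_eq {k : ℤ} (φ : Module.Dual F V.Total)
    (h : ∀ j, j ≠ k → ∀ x, φ (V.incl j x) = 0) :
    ∃ ζ ∈ (GrVect.dual.{u, v} V).weight k, pairing.{u, v} V ζ = φ := by
  refine ⟨GrVect.dualIncl.{u, v} V k (φ ∘ₗ V.incl k), ⟨_, rfl⟩, ?_⟩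
  refine DirectSum.linearMap_ext F fun j => LinearMap.ext fun x => ?_
  simp only [LinearMap.comp_apply]
  by_cases hj : j = k
  · subst hj
    exact pairing_dualIncl_incl V j _ x
  · rw [h j hj]
    exact pairing_dualIncl_incl_of_ne V (Ne.symm hj) _ x

theorem tensorPairing_map_dualIncl (i j : ℤ) (X : Module.Dual F (V i) ⊗[F] Module.Dual F (V j))
    (x : V i) (y : V j) :
    tensorPairing.{u, v} V (TensorProduct.map (GrVect.dualIncl.{u, v} V i)
        (GrVect.dualIncl.{u, v} V j) X) (V.incl i x ⊗ₜ V.incl j y)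
      = TensorProduct.dualDistrib F (V i) (V j) X (x ⊗ₜ y) := by
  induction X with
  | zero => simp
  | add X Z hX hZ => simp only [map_add, LinearMap.add_apply, hX, hZ]
  | tmul f g =>
    rw [tensorPairing_eq_pairingSq, TensorProduct.map_tmul, pairingSq_tmul, pairing_dualIncl_incl,
      pairing_dualIncl_incl, TensorProduct.dualDistrib_apply]

theorem tensorPairing_map_dualIncl_of_ne {i a : ℤ} (j b : ℤ) (h : i ≠ a)
    (X : Module.Dual F (V i) ⊗[F] Module.Dual F (V j)) (x : V a) (y : V b) :
    tensorPairing.{u, v} V (TensorProduct.map (GrVect.dualIncl.{u, v} V i)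
        (GrVect.dualIncl.{u, v} V j) X) (V.incl a x ⊗ₜ V.incl b y) = 0 := by
  induction X with
  | zero => simp
  | add X Z hX hZ => simp only [map_add, LinearMap.add_apply, hX, hZ, add_zero]
  | tmul f g =>
    rw [tensorPairing_eq_pairingSq, TensorProduct.map_tmul, pairingSq_tmul,
      pairing_dualIncl_incl_of_ne V h, zero_mul]

theorem tensorPairing_map_dualIncl_of_ne' (i a : ℤ) {j b : ℤ} (h : j ≠ b)
    (X : Module.Dual F (V i) ⊗[F] Module.Dual F (V j)) (x : V a) (y : V b) :
    tensorPairing.{u, v} V (TensorProduct.map (GrVect.dualIncl.{u, v} V i)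
        (GrVect.dualIncl.{u, v} V j) X) (V.incl a x ⊗ₜ V.incl b y) = 0 := by
  induction X with
  | zero => simp
  | add X Z hX hZ => simp only [map_add, LinearMap.add_apply, hX, hZ, add_zero]
  | tmul f g =>
    rw [tensorPairing_eq_pairingSq, TensorProduct.map_tmul, pairingSq_tmul,
      pairing_dualIncl_incl_of_ne V h, mul_zero]

theorem GrVect.tensor_dual_ext {φ ψ : Module.Dual F (V.Total ⊗[F] V.Total)}
    (h : ∀ a b x y, φ (V.incl a x ⊗ₜ V.incl b y) = ψ (V.incl a x ⊗ₜ V.incl b y)) : φ = ψ := by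
  refine TensorProduct.ext' fun x y => ?_
  induction x using GrVect.induction_on with
  | zero => simp
  | add x x' hx hx' => simp only [add_tmul, map_add, hx, hx']
  | incl a x =>
    induction y using GrVect.induction_on with
    | zero => simp
    | add y y' hy hy' => simp only [tmul_add, map_add, hy, hy']
    | incl b y => exact h a b x y

/-- A functional on `V ⊗ V` supported in degree `k` is represented by a tensor of degree `k`. -/
theorem exists_tensorPairing_eq (hV : V.BoundedBelow) (hfin : ∀ k, FiniteDimensional F (V k))
    {k : ℤ} (φ : Module.Dual F (V.Total ⊗[F] V.Total))
    (h : ∀ a b, a + b ≠ k → ∀ x y, φ (V.incl a x ⊗ₜ V.incl b y) = 0) :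
    ∃ X ∈ (GrVect.dual.{u, v} V).tensorWeight k, tensorPairing.{u, v} V X = φ := by
  obtain ⟨N, hN⟩ := hV
  -- Finite dimension enters here: every functional on `V_i ⊗ V_{k-i}` comes from a tensor of
  -- functionals.
  have hZ : ∀ i, ∃ Z : Module.Dual F (V i) ⊗[F] Module.Dual F (V (k - i)),
      TensorProduct.dualDistrib F (V i) (V (k - i)) Z
        = φ ∘ₗ TensorProduct.map (V.incl i) (V.incl (k - i)) := fun i =>
    (TensorProduct.dualDistribEquiv F (V i) (V (k - i))).surjective _
  choose Z hZ using hZ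
  -- For `i < N` the space `V_i` vanishes, and for `i > k - N` the space `V_{k-i}` does, so this
  -- finite sum misses nothing.
  refine ⟨∑ i ∈ Finset.Icc N (k - N), TensorProduct.map (GrVect.dualIncl.{u, v} V i)
    (GrVect.dualIncl.{u, v} V (k - i)) (Z i), ?_, ?_⟩
  · exact Submodule.sum_mem _ fun i _ => Submodule.mem_iSup_of_mem i ⟨Z i, rfl⟩
  · refine GrVect.tensor_dual_ext fun a b x y => ?_
    rw [map_sum, LinearMap.sum_apply]
    by_cases hab : a + b = k
    · obtain rfl : b = k - a := by omega
      rw [Finset.sum_eq_single a, tensorPairing_map_dualIncl, hZ]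
      · rfl
      · intro i _ hi
        exact tensorPairing_map_dualIncl_of_ne _ _ hi _ _ _
      · intro ha
        have : x = 0 ∨ y = 0 := by
          rw [Finset.mem_Icc, not_and_or, not_le, not_le] at ha
          rcases ha with ha | ha
          · have := hN a ha
            exact Or.inl (Subsingleton.elim _ _)
          · have := hN (k - a) (by omega)
            exact Or.inr (Subsingleton.elim _ _)
        rcases this with rfl | rfl <;> simp
    · rw [h a b hab]
      refine Finset.sum_eq_zero fun i _ => ?_
      by_cases hi : i = a
      · exact tensorPairing_map_dualIncl_of_ne' _ _ (by omega) _ _ _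
      · exact tensorPairing_map_dualIncl_of_ne _ _ hi _ _ _

theorem tensorPairing_eq_zero_of_mem {j k m : ℤ} (f : Module.Dual F (V j))
    (g : Module.Dual F (V k)) {X : V.Total ⊗[F] V.Total} (hX : X ∈ V.tensorWeight m)
    (h : j + k ≠ m) :
    tensorPairing.{u, v} V
      (GrVect.dualIncl.{u, v} V j f ⊗ₜ GrVect.dualIncl.{u, v} V k g) X = 0 := by
  suffices V.tensorWeight m ≤ LinearMap.ker (tensorPairing.{u, v} V
      (GrVect.dualIncl.{u, v} V j f ⊗ₜ GrVect.dualIncl.{u, v} V k g)) from this hX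
  refine iSup_le fun i => ?_
  rintro _ ⟨X, rfl⟩
  rw [LinearMap.mem_ker]
  induction X with
  | zero => simp
  | add X Z hX hZ => simp only [map_add, hX, hZ, add_zero]
  | tmul x y =>
    rw [tensorPairing_eq_pairingSq, TensorProduct.map_tmul, pairingSq_tmul]
    by_cases hi : j = i
    · exact mul_eq_zero_of_right _ (pairing_dualIncl_incl_of_ne V (by omega) g y)
    · exact mul_eq_zero_of_left (pairing_dualIncl_incl_of_ne V hi f x) _

/-- Checked degree by degree, where it is the reflexivity of a finite-dimensional space. -/
instance isIso_toDoubleDual [∀ k, FiniteDimensional F (V k)] : IsIso (toDoubleDual.{u, v} V) := by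
  rw [isIso_pi_iff]
  intro k
  exact (LinearEquiv.toModuleIso (Module.evalEquiv F (V k))).isIso_hom

end GradedDual

/-- A linear map factors through an injective one whose range contains its range. -/
theorem exists_comp_eq_of_range_le {F : Type*} [Field F] {M N L : Type*} [AddCommGroup M]
    [Module F M] [AddCommGroup N] [Module F N] [AddCommGroup L] [Module F L] {p : M →ₗ[F] L}
    (hp : Function.Injective p) (q : N →ₗ[F] L) (h : ∀ x, q x ∈ LinearMap.range p) :
    ∃ g : N →ₗ[F] M, ∀ x, p (g x) = q x := by
  refine ⟨(LinearEquiv.ofInjective p hp).symm ∘ₗ q.codRestrict _ h, fun x => ?_⟩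
  have := LinearEquiv.ofInjective_apply p (h := hp)
    ((LinearEquiv.ofInjective p hp).symm (q.codRestrict _ h x))
  rw [LinearEquiv.apply_symm_apply] at this
  exact this.symm

/-! ### The dual vertex coalgebra of a vertex algebra -/

section DualCoalgebra

variable {F : Type u} [Field F] (A : FDGVertexAlgebra.{u, max u v} F)

theorem FDGVertexAlgebra.Y_incl_mem (j k n : ℤ) (x : A.space j) (y : A.space k) :
    A.str.Y (A.space.incl j x) n (A.space.incl k y) ∈ A.space.weight (j + k + n) := by
  have := A.graded j k (-n - 1) _ (A.space.incl_mem_weight j x) _ (A.space.incl_mem_weight k y)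
  rwa [show -(-n - 1) - 1 = n by ring, show j + k - (-n - 1) - 1 = j + k + n by ring] at this

theorem pairing_eq_zero_of_mem {V : GrVect.{u, max u v} F} {j k : ℤ} (f : Module.Dual F (V j))
    {x : V.Total} (hx : x ∈ V.weight k) (h : j ≠ k) :
    pairing.{u, v} V (GrVect.dualIncl.{u, v} V j f) x = 0 := by
  obtain ⟨x, rfl⟩ := hx
  exact pairing_dualIncl_incl_of_ne V h f x

/-- The transposed product of a homogeneous functional is a homogeneous tensor. -/
theorem FDGVertexAlgebra.exists_coproduct_dualIncl (r n : ℤ) (f : Module.Dual F (A.space r)) :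
    ∃ X ∈ (GrVect.dual.{u, v} A.space).tensorWeight (r - n),
      tensorPairing.{u, v} A.space X
        = pairing.{u, v} A.space (GrVect.dualIncl.{u, v} A.space r f)
          ∘ₗ TensorProduct.lift (LinearMap.proj n ∘ₗ A.str.Y) := by
  refine exists_tensorPairing_eq A.boundedBelow A.finite _ fun a b hab x y => ?_
  rw [LinearMap.comp_apply, TensorProduct.lift.tmul]
  exact pairing_eq_zero_of_mem f (A.Y_incl_mem a b n x y) (by omega)

/-- By linearity it is enough that homogeneous functionals transpose into the image of `V' ⊗ V'`;
injectivity of the pairing then makes the lift unique, hence linear. -/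
theorem FDGVertexAlgebra.exists_coproduct :
    ∃ D : (GrVect.dual.{u, v} A.space).Total →ₗ[F]
        (ℤ → (GrVect.dual.{u, v} A.space).Total ⊗[F] (GrVect.dual.{u, v} A.space).Total),
      ∀ ξ v w n, pairingSq (pairing.{u, v} A.space) (D ξ n) (v ⊗ₜ w)
        = pairing.{u, v} A.space ξ (A.str.Y v n w) := by
  have key : ∀ n : ℤ, ∃ D : (GrVect.dual.{u, v} A.space).Total →ₗ[F]
      (GrVect.dual.{u, v} A.space).Total ⊗[F] (GrVect.dual.{u, v} A.space).Total,
      ∀ ξ, tensorPairing.{u, v} A.space (D ξ)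
        = ((TensorProduct.lift (LinearMap.proj n ∘ₗ A.str.Y)).dualMap
            ∘ₗ pairing.{u, v} A.space) ξ := by
    intro n
    refine exists_comp_eq_of_range_le (tensorPairing_injective A.space) _ fun ξ => ?_
    induction ξ using GrVect.induction_on with
    | zero => rw [map_zero]; exact Submodule.zero_mem _
    | add x y hx hy => rw [map_add]; exact Submodule.add_mem _ hx hy
    | incl r f =>
      obtain ⟨X, -, hX⟩ := A.exists_coproduct_dualIncl r n f
      exact ⟨X, hX⟩
  choose D hD using key
  refine ⟨LinearMap.pi D, fun ξ v w n => ?_⟩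
  exact LinearMap.congr_fun (hD n ξ) (v ⊗ₜ w)

/-- The coproduct of the graded dual, `⟨Y(x) ξ, v ⊗ w⟩ = ⟨ξ, Y(v, x) w⟩`. -/
def FDGVertexAlgebra.coproduct : (GrVect.dual.{u, v} A.space).Total →ₗ[F]
    (ℤ → (GrVect.dual.{u, v} A.space).Total ⊗[F] (GrVect.dual.{u, v} A.space).Total) :=
  Classical.choose A.exists_coproduct

theorem FDGVertexAlgebra.pairingSq_coproduct (ξ : (GrVect.dual.{u, v} A.space).Total)
    (v w : A.space.Total) (n : ℤ) :
    pairingSq (pairing.{u, v} A.space) (A.coproduct ξ n) (v ⊗ₜ w)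
      = pairing.{u, v} A.space ξ (A.str.Y v n w) :=
  Classical.choose_spec A.exists_coproduct ξ v w n

theorem FDGVertexAlgebra.coproduct_mem (r n : ℤ) {ξ : (GrVect.dual.{u, v} A.space).Total}
    (hξ : ξ ∈ (GrVect.dual.{u, v} A.space).weight r) :
    A.coproduct ξ n ∈ (GrVect.dual.{u, v} A.space).tensorWeight (r - n) := by
  obtain ⟨f, rfl⟩ := hξ
  obtain ⟨X, hX, h⟩ := A.exists_coproduct_dualIncl r n f
  convert hX
  apply tensorPairing_injective
  rw [h]
  refine TensorProduct.ext' fun v w => ?_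
  exact A.pairingSq_coproduct _ v w n

theorem FDGVertexAlgebra.coproduct_truncation (ξ : (GrVect.dual.{u, v} A.space).Total) :
    ∃ N : ℤ, ∀ n > N, A.coproduct ξ n = 0 := by
  obtain ⟨M, hM⟩ := A.boundedBelow.dual
  induction ξ using GrVect.induction_on with
  | zero => exact ⟨0, fun n _ => by rw [map_zero]; rfl⟩
  | add x y hx hy =>
    obtain ⟨N₁, h₁⟩ := hx
    obtain ⟨N₂, h₂⟩ := hy
    refine ⟨max N₁ N₂, fun n hn => ?_⟩
    rw [map_add, Pi.add_apply, h₁ n (by omega), h₂ n (by omega), add_zero]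
  | incl r f =>
    -- Beyond this bound the coefficient has degree `r - n < 2 * M`, where the tensor square is
    -- zero.
    refine ⟨r - 2 * M, fun n hn => ?_⟩
    have := A.coproduct_mem r n (GrVect.incl_mem_weight _ r f)
    rwa [GrVect.tensorWeight_eq_bot hM (by omega), Submodule.mem_bot] at this

/-- The graded dual of a graded vertex algebra, as a graded vertex coalgebra. -/
def FDGVertexAlgebra.dual : FDGVertexCoalgebra.{u, max u v} F where
  space := GrVect.dual.{u, v} A.space
  str :=
    { Y := A.coproduct
      c := (pairing.{u, v} A.space).flip A.str.vac
      counit := fun ξ n => by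
        apply pairing_injective
        refine LinearMap.ext fun w => ?_
        rw [pairing_lid_rTensor (e := A.str.vac) (fun _ => rfl), A.pairingSq_coproduct,
          A.str.vacuum]
        split_ifs <;> simp
      cocreation := fun ξ n hn => by
        apply pairing_injective
        refine LinearMap.ext fun w => ?_
        rw [pairing_rid_lTensor (e := A.str.vac) (fun _ => rfl), A.pairingSq_coproduct,
          A.str.creation w n hn, map_zero, map_zero, LinearMap.zero_apply]
      cocreation_zero := fun ξ => by
        apply pairing_injective
        refine LinearMap.ext fun w => ?_
        rw [pairing_rid_lTensor (e := A.str.vac) (fun _ => rfl), A.pairingSq_coproduct,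
          A.str.creation_zero]
      truncation := A.coproduct_truncation
      jacobi := fun ξ a b c => by
        rw [← cojacobiator_eq_zero_iff]
        apply pairingCube_injective (pairing_injective A.space)
        rw [map_zero]
        refine TensorProduct.ext_threefold' fun u v w => ?_
        rw [pairingCube_cojacobiator A.pairingSq_coproduct A.coproduct_truncation
          A.str.truncation, (jacobiator_eq_zero_iff _ _ _ _ _ _ _).2 (A.str.jacobi u v w a b c),
          map_zero, LinearMap.zero_apply] }
  boundedBelow := A.boundedBelow.dual
  finite := GrVect.finite_dual A.finite
  graded := fun r k ξ hξ => by
    have := A.coproduct_mem r (-k - 1) hξ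
    rwa [show r - (-k - 1) = r + k + 1 by ring] at this

end DualCoalgebra

/-! ### The dual vertex algebra of a vertex coalgebra -/

section DualAlgebra

variable {F : Type u} [Field F] (C : FDGVertexCoalgebra.{u, max u v} F)

theorem FDGVertexCoalgebra.Y_incl_mem (r n : ℤ) (x : C.space r) :
    C.str.Y (C.space.incl r x) n ∈ C.space.tensorWeight (r - n) := by
  have := C.graded r (-n - 1) _ (C.space.incl_mem_weight r x)
  rwa [show -(-n - 1) - 1 = n by ring, show r + (-n - 1) + 1 = r - n by ring] at this

/-- Contraction of a homogeneous tensor by a functional, in terms of the degree zero part of the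
functional. -/
theorem GrVect.rid_lTensor_apply {V : GrVect.{u, v} F} {r : ℤ} (c : V.Total →ₗ[F] F)
    {X : V.Total ⊗[F] V.Total} (hX : X ∈ V.tensorWeight r) :
    V.incl r ((TensorProduct.rid F V.Total (c.lTensor V.Total X)) r)
      = TensorProduct.rid F V.Total
        ((c ∘ₗ V.incl 0 ∘ₗ DirectSum.component F ℤ (fun k => V k) 0).lTensor V.Total X) := by
  suffices V.tensorWeight r ≤ LinearMap.eqLocus
      (V.incl r ∘ₗ DirectSum.component F ℤ (fun k => V k) r
        ∘ₗ (TensorProduct.rid F V.Total).toLinearMap ∘ₗ c.lTensor V.Total)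
      ((TensorProduct.rid F V.Total).toLinearMap
        ∘ₗ (c ∘ₗ V.incl 0 ∘ₗ DirectSum.component F ℤ (fun k => V k) 0).lTensor V.Total) from
    this hX
  refine iSup_le fun i => ?_
  rintro _ ⟨X, rfl⟩
  rw [LinearMap.mem_eqLocus]
  induction X with
  | zero => simp
  | add X Z hX hZ => simp only [map_add, hX, hZ]
  | tmul x y =>
    simp only [TensorProduct.map_tmul, LinearMap.comp_apply, LinearMap.lTensor_tmul,
      LinearEquiv.coe_coe, TensorProduct.rid_tmul, map_smul, ← DirectSum.apply_eq_component]
    -- For a tensor in `V_i ⊗ V_{r-i}` both sides vanish unless `i = r`, and then the second factor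
    -- has degree zero, where `c` agrees with its degree zero part.
    by_cases hi : i = r
    · subst hi
      -- The degree of `y` equals `0` only propositionally; generalizing it allows the type of `y`
      -- to be rewritten.
      generalize hm : i - i = m at y ⊢
      obtain rfl : m = 0 := by omega
      rw [DirectSum.lof_apply, DirectSum.lof_apply]
    · rw [V.incl_apply_of_ne hi, V.incl_apply_of_ne (show r - i ≠ 0 by omega)]
      simp

/-- The covacuum map vanishes outside degree zero. -/
theorem FDGVertexCoalgebra.c_incl_of_ne {r : ℤ} (hr : r ≠ 0) (x : C.space r) :
    C.str.c (C.space.incl r x) = 0 := by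
  -- Let `X` be the constant coefficient of the coproduct of `x`, homogeneous of degree `r`, and
  -- `c₀` the degree zero part of `c`. Cocreation and homogeneity give `x = (Id ⊗ c₀) X`. Applying
  -- `c` and then the counit axiom, `c x = (c ⊗ c₀) X = c₀ ((c ⊗ Id) X) = c₀ x`, which is `0` as `r
  -- ≠ 0`.
  have hX := C.Y_incl_mem r 0 x
  rw [sub_zero] at hX
  have h₁ := C.str.counit (C.space.incl r x) 0
  have h₂ := C.space.rid_lTensor_apply C.str.c hX
  rw [C.str.cocreation_zero, DirectSum.lof_apply] at h₂
  rw [if_pos rfl] at h₁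
  have h₃ : ∀ (c₀ : C.space.Total →ₗ[F] F) (X : C.space.Total ⊗[F] C.space.Total),
      C.str.c (TensorProduct.rid F C.space.Total (c₀.lTensor C.space.Total X))
        = c₀ (TensorProduct.lid F C.space.Total (C.str.c.rTensor C.space.Total X)) := by
    intro c₀ X
    induction X with
    | zero => simp
    | add X Z hX hZ => simp only [map_add, hX, hZ]
    | tmul x y => simp [mul_comm]
  rw [h₂, h₃, h₁, LinearMap.comp_apply, LinearMap.comp_apply, ← DirectSum.apply_eq_component,
    C.space.incl_apply_of_ne hr, map_zero, map_zero]

/-- The coefficient of `x ^ n` in the coproduct lowers degree by `n`, so only degree `j + k + n`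
pairs nontrivially with `f ⊗ g`. -/
theorem FDGVertexCoalgebra.exists_product_dualIncl (j k n : ℤ) (f : Module.Dual F (C.space j))
    (g : Module.Dual F (C.space k)) :
    ∃ ζ ∈ (GrVect.dual.{u, v} C.space).weight (j + k + n),
      pairing.{u, v} C.space ζ
        = tensorPairing.{u, v} C.space
            (GrVect.dualIncl.{u, v} C.space j f ⊗ₜ GrVect.dualIncl.{u, v} C.space k g)
          ∘ₗ LinearMap.proj n ∘ₗ C.str.Y := by
  refine exists_pairing_eq _ fun r hr x => ?_
  exact tensorPairing_eq_zero_of_mem f g (C.Y_incl_mem r n x) (by omega)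

/-- The adjunction is stated with the flipped pairing, so that the coproduct of `C` takes the role
of `D` in the abstract lemmas. -/
theorem FDGVertexCoalgebra.exists_product :
    ∃ Y : (GrVect.dual.{u, v} C.space).Total →ₗ[F]
        (ℤ → Module.End F (GrVect.dual.{u, v} C.space).Total),
      ∀ w f g n, pairingSq (pairing.{u, v} C.space).flip (C.str.Y w n) (f ⊗ₜ g)
        = (pairing.{u, v} C.space).flip w (Y f n g) := by
  have key : ∀ n : ℤ, ∃ m : (GrVect.dual.{u, v} C.space).Total ⊗[F]
      (GrVect.dual.{u, v} C.space).Total →ₗ[F] (GrVect.dual.{u, v} C.space).Total,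
      ∀ X, pairing.{u, v} C.space (m X)
        = ((LinearMap.proj n ∘ₗ C.str.Y).dualMap ∘ₗ tensorPairing.{u, v} C.space) X := by
    intro n
    refine exists_comp_eq_of_range_le (pairing_injective C.space) _ fun X => ?_
    induction X with
    | zero => rw [map_zero]; exact Submodule.zero_mem _
    | add x y hx hy => rw [map_add]; exact Submodule.add_mem _ hx hy
    | tmul f g =>
      induction f using GrVect.induction_on with
      | zero => rw [zero_tmul, map_zero]; exact Submodule.zero_mem _
      | add x y hx hy => rw [add_tmul, map_add]; exact Submodule.add_mem _ hx hy
      | incl j f =>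
        induction g using GrVect.induction_on with
        | zero => rw [tmul_zero, map_zero]; exact Submodule.zero_mem _
        | add x y hx hy => rw [tmul_add, map_add]; exact Submodule.add_mem _ hx hy
        | incl k g =>
          obtain ⟨ζ, -, hζ⟩ := C.exists_product_dualIncl j k n f g
          exact ⟨ζ, hζ⟩
  choose m hm using key
  refine ⟨LinearMap.pi fun n => TensorProduct.curry (m n), fun w f g n => ?_⟩
  rw [pairingSq_flip]
  exact (LinearMap.congr_fun (hm n (f ⊗ₜ g)) w).symm

/-- The product on the graded dual, `⟨Y(f, x) g, w⟩ = ⟨f ⊗ g, Y(x) w⟩`. -/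
def FDGVertexCoalgebra.product : (GrVect.dual.{u, v} C.space).Total →ₗ[F]
    (ℤ → Module.End F (GrVect.dual.{u, v} C.space).Total) :=
  Classical.choose C.exists_product

theorem FDGVertexCoalgebra.pairingSq_flip_product (w : C.space.Total)
    (f g : (GrVect.dual.{u, v} C.space).Total) (n : ℤ) :
    pairingSq (pairing.{u, v} C.space).flip (C.str.Y w n) (f ⊗ₜ g)
      = (pairing.{u, v} C.space).flip w (FDGVertexCoalgebra.product.{u, v} C f n g) :=
  Classical.choose_spec (FDGVertexCoalgebra.exists_product.{u, v} C) w f g n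

theorem FDGVertexCoalgebra.pairing_product (w : C.space.Total)
    (f g : (GrVect.dual.{u, v} C.space).Total) (n : ℤ) :
    pairing.{u, v} C.space (C.product f n g) w
      = tensorPairing.{u, v} C.space (f ⊗ₜ g) (C.str.Y w n) := by
  rw [tensorPairing_eq_pairingSq, ← pairingSq_flip, C.pairingSq_flip_product]
  rfl

theorem FDGVertexCoalgebra.product_mem (j k n : ℤ) {f g : (GrVect.dual.{u, v} C.space).Total}
    (hf : f ∈ (GrVect.dual.{u, v} C.space).weight j)
    (hg : g ∈ (GrVect.dual.{u, v} C.space).weight k) :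
    C.product f n g ∈ (GrVect.dual.{u, v} C.space).weight (j + k + n) := by
  obtain ⟨f, rfl⟩ := hf
  obtain ⟨g, rfl⟩ := hg
  obtain ⟨ζ, hζ, h⟩ := C.exists_product_dualIncl j k n f g
  convert hζ
  apply pairing_injective
  rw [h]
  refine LinearMap.ext fun w => ?_
  exact C.pairing_product w _ _ n

theorem FDGVertexCoalgebra.product_truncation (f g : (GrVect.dual.{u, v} C.space).Total) :
    ∃ N : ℤ, ∀ n < N, C.product f n g = 0 := by
  obtain ⟨M, hM⟩ := C.boundedBelow.dual
  induction f using GrVect.induction_on with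
  | zero => exact ⟨0, fun n _ => by rw [map_zero]; rfl⟩
  | add x y hx hy =>
    obtain ⟨N₁, h₁⟩ := hx
    obtain ⟨N₂, h₂⟩ := hy
    refine ⟨min N₁ N₂, fun n hn => ?_⟩
    rw [map_add, Pi.add_apply, LinearMap.add_apply, h₁ n (by omega), h₂ n (by omega), add_zero]
  | incl j f =>
    induction g using GrVect.induction_on with
    | zero => exact ⟨0, fun n _ => by rw [map_zero]⟩
    | add x y hx hy =>
      obtain ⟨N₁, h₁⟩ := hx
      obtain ⟨N₂, h₂⟩ := hy
      refine ⟨min N₁ N₂, fun n hn => ?_⟩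
      rw [map_add, h₁ n (by omega), h₂ n (by omega), add_zero]
    | incl k g =>
      -- Below this bound the product has degree `j + k + n < M`.
      refine ⟨M - j - k, fun n hn => ?_⟩
      have := C.product_mem j k n (GrVect.incl_mem_weight _ j f) (GrVect.incl_mem_weight _ k g)
      rwa [GrVect.weight_eq_bot (hM _ (by omega)), Submodule.mem_bot] at this

/-- A functional on `V` need not belong to `V'`; `c` does because it is concentrated in degree zero.
-/
theorem FDGVertexCoalgebra.exists_vac :
    ∃ e : (GrVect.dual.{u, v} C.space).Total, pairing.{u, v} C.space e = C.str.c := by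
  obtain ⟨e, -, he⟩ := exists_pairing_eq.{u, v} C.str.c fun j hj x => C.c_incl_of_ne hj x
  exact ⟨e, he⟩

/-- The vacuum of the graded dual. -/
def FDGVertexCoalgebra.vac : (GrVect.dual.{u, v} C.space).Total := Classical.choose C.exists_vac

theorem FDGVertexCoalgebra.pairing_vac : pairing.{u, v} C.space C.vac = C.str.c :=
  Classical.choose_spec C.exists_vac

theorem FDGVertexCoalgebra.c_eq (w : C.space.Total) :
    C.str.c w = (pairing.{u, v} C.space).flip w C.vac := by
  rw [LinearMap.flip_apply, C.pairing_vac]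

/-- The graded dual of a graded vertex coalgebra, as a graded vertex algebra. -/
def FDGVertexCoalgebra.dual : FDGVertexAlgebra.{u, max u v} F where
  space := GrVect.dual.{u, v} C.space
  str :=
    { Y := C.product
      vac := C.vac
      truncation := C.product_truncation
      vacuum := fun g n => by
        apply pairing_injective
        refine LinearMap.ext fun w => ?_
        rw [← LinearMap.flip_apply, ← C.pairingSq_flip_product, ← pairing_lid_rTensor C.c_eq,
          C.str.counit]
        split_ifs <;> simp
      creation := fun f n hn => by
        apply pairing_injective
        refine LinearMap.ext fun w => ?_
        rw [← LinearMap.flip_apply, ← C.pairingSq_flip_product, ← pairing_rid_lTensor C.c_eq,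
          C.str.cocreation w n hn]
        simp
      creation_zero := fun f => by
        apply pairing_injective
        refine LinearMap.ext fun w => ?_
        rw [← LinearMap.flip_apply, ← C.pairingSq_flip_product, ← pairing_rid_lTensor C.c_eq,
          C.str.cocreation_zero]
        simp
      jacobi := fun f g h a b c => by
        rw [← jacobiator_eq_zero_iff]
        apply pairing_injective
        refine LinearMap.ext fun w => ?_
        rw [← LinearMap.flip_apply, ← pairingCube_cojacobiator C.pairingSq_flip_product
          C.str.truncation C.product_truncation,
          (cojacobiator_eq_zero_iff _ _ _ _ _).2 (C.str.jacobi w a b c)]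
        simp }
  boundedBelow := C.boundedBelow.dual
  finite := GrVect.finite_dual C.finite
  graded := fun j k n f hf g hg => by
    have := C.product_mem j k (-n - 1) hf hg
    rwa [show j + k + (-n - 1) = j + k - n - 1 by ring] at this

end DualAlgebra

/-! ### The duality functors -/

section Functors

variable {F : Type u} [Field F]

theorem FDGVertexAlgebra.tensorPairing_dual_Y (A : FDGVertexAlgebra.{u, max u v} F)
    (ξ : (GrVect.dual.{u, v} A.space).Total) (v w : A.space.Total) (n : ℤ) :
    tensorPairing.{u, v} A.space ((FDGVertexAlgebra.dual.{u, v} A).str.Y ξ n) (v ⊗ₜ w)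
      = pairing.{u, v} A.space ξ (A.str.Y v n w) :=
  FDGVertexAlgebra.pairingSq_coproduct.{u, v} A ξ v w n

theorem FDGVertexCoalgebra.pairing_dual_Y (C : FDGVertexCoalgebra.{u, max u v} F)
    (f g : (GrVect.dual.{u, v} C.space).Total) (w : C.space.Total) (n : ℤ) :
    pairing.{u, v} C.space ((FDGVertexCoalgebra.dual.{u, v} C).str.Y f n g) w
      = tensorPairing.{u, v} C.space (f ⊗ₜ g) (C.str.Y w n) :=
  FDGVertexCoalgebra.pairing_product.{u, v} C w f g n

/-- The transpose of a morphism of graded vertex algebras. -/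
def FDGVertexAlgebra.dualMap {A B : FDGVertexAlgebra.{u, max u v} F} (f : A ⟶ B) :
    FDGVertexAlgebra.dual.{u, v} B ⟶ FDGVertexAlgebra.dual.{u, v} A where
  map := (gradedDual.{u, v} F).map (FDGVertexAlgebra.Hom.map f).op
  map_Y ξ n := by
    apply tensorPairing_injective A.space
    refine TensorProduct.ext' fun v w => ?_
    refine Eq.trans ?_ (FDGVertexAlgebra.tensorPairing_dual_Y.{u, v} A _ v w n).symm
    -- Moving `f` across the pairing turns the claim into `⟨ξ, Y(f v, x) f w⟩ = ⟨ξ, f (Y(v, x) w)⟩`.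
    refine Eq.trans (pairingSq_map (pairing_total_gradedDual_map.{u, v} f.map) _ _) ?_
    refine Eq.trans (FDGVertexAlgebra.tensorPairing_dual_Y.{u, v} B ξ _ _ n) ?_
    rw [← f.map_Y]
    exact (pairing_total_gradedDual_map.{u, v} f.map _ _).symm
  map_c ξ := by
    refine Eq.trans (pairing_total_gradedDual_map.{u, v} f.map ξ A.str.vac) ?_
    rw [f.map_vac]
    rfl

/-- The transpose of a morphism of graded vertex coalgebras. -/
def FDGVertexCoalgebra.dualMap {C D : FDGVertexCoalgebra.{u, max u v} F} (f : C ⟶ D) :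
    FDGVertexCoalgebra.dual.{u, v} D ⟶ FDGVertexCoalgebra.dual.{u, v} C where
  map := (gradedDual.{u, v} F).map (FDGVertexCoalgebra.Hom.map f).op
  map_Y ξ η n := by
    apply pairing_injective C.space
    refine LinearMap.ext fun w => ?_
    refine Eq.trans ?_ (FDGVertexCoalgebra.pairing_dual_Y.{u, v} C _ _ w n).symm
    refine Eq.trans (pairing_total_gradedDual_map.{u, v} f.map _ _) ?_
    refine Eq.trans (FDGVertexCoalgebra.pairing_dual_Y.{u, v} D ξ η _ n) ?_
    rw [← f.map_Y]
    exact (pairingSq_map (pairing_total_gradedDual_map.{u, v} f.map) (ξ ⊗ₜ η) _).symm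
  map_vac := by
    apply pairing_injective C.space
    refine LinearMap.ext fun w => ?_
    refine Eq.trans (pairing_total_gradedDual_map.{u, v} f.map _ _) ?_
    refine Eq.trans (LinearMap.congr_fun (FDGVertexCoalgebra.pairing_vac.{u, v} D) _) ?_
    refine Eq.trans (f.map_c w) ?_
    exact (LinearMap.congr_fun (FDGVertexCoalgebra.pairing_vac.{u, v} C) w).symm

variable (F) in
/-- Graded dualization, from graded vertex algebras to graded vertex coalgebras. -/
def dualCoalgebraFunctor :
    (FDGVertexAlgebra.{u, max u v} F)ᵒᵖ ⥤ FDGVertexCoalgebra.{u, max u v} F where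
  obj A := FDGVertexAlgebra.dual.{u, v} A.unop
  map f := FDGVertexAlgebra.dualMap.{u, v} f.unop
  map_id A := FDGVertexCoalgebra.Hom.ext ((gradedDual.{u, v} F).map_id (op A.unop.space))
  map_comp f g := FDGVertexCoalgebra.Hom.ext
    ((gradedDual.{u, v} F).map_comp f.unop.map.op g.unop.map.op)

variable (F) in
/-- Graded dualization, from graded vertex coalgebras to graded vertex algebras. -/
def dualAlgebraFunctor :
    FDGVertexCoalgebra.{u, max u v} F ⥤ (FDGVertexAlgebra.{u, max u v} F)ᵒᵖ where
  obj C := op (FDGVertexCoalgebra.dual.{u, v} C)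
  map f := (FDGVertexCoalgebra.dualMap.{u, v} f).op
  map_id C := congrArg Quiver.Hom.op
    (FDGVertexAlgebra.Hom.ext ((gradedDual.{u, v} F).map_id (op C.space)))
  map_comp f g := congrArg Quiver.Hom.op
    (FDGVertexAlgebra.Hom.ext ((gradedDual.{u, v} F).map_comp g.map.op f.map.op))

/-! ### The double dual -/

/-- A morphism of graded vertex algebras which is an isomorphism of graded vector spaces is an
isomorphism. -/
def FDGVertexAlgebra.isoOfIsIso {A B : FDGVertexAlgebra.{u, v} F} (f : A ⟶ B)
    [IsIso (FDGVertexAlgebra.Hom.map f)] : A ≅ B where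
  hom := f
  inv :=
    { map := inv f.map
      map_Y := fun u w n => by
        have h : ∀ x, GrVect.total f.map (GrVect.total (inv f.map) x) = x := fun x => by
          rw [← LinearMap.comp_apply, ← GrVect.total_comp, IsIso.inv_hom_id, GrVect.total_id]
          rfl
        have h' : ∀ x, GrVect.total (inv f.map) (GrVect.total f.map x) = x := fun x => by
          rw [← LinearMap.comp_apply, ← GrVect.total_comp, IsIso.hom_inv_id, GrVect.total_id]
          rfl
        rw [← h' (A.str.Y _ n _), f.map_Y, h, h]
      map_vac := by
        rw [← f.map_vac, ← LinearMap.comp_apply, ← GrVect.total_comp, IsIso.hom_inv_id,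
          GrVect.total_id]
        rfl }
  hom_inv_id := FDGVertexAlgebra.Hom.ext (IsIso.hom_inv_id f.map)
  inv_hom_id := FDGVertexAlgebra.Hom.ext (IsIso.inv_hom_id f.map)

/-- A morphism of graded vertex coalgebras which is an isomorphism of graded vector spaces is an
isomorphism. -/
def FDGVertexCoalgebra.isoOfIsIso {C D : FDGVertexCoalgebra.{u, v} F} (f : C ⟶ D)
    [IsIso (FDGVertexCoalgebra.Hom.map f)] : C ≅ D where
  hom := f
  inv :=
    { map := inv f.map
      map_Y := fun w n => by
        have h : ∀ x, GrVect.total f.map (GrVect.total (inv f.map) x) = x := fun x => by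
          rw [← LinearMap.comp_apply, ← GrVect.total_comp, IsIso.inv_hom_id, GrVect.total_id]
          rfl
        conv_lhs => rw [← h w]
        rw [← f.map_Y, ← LinearMap.comp_apply, ← TensorProduct.map_comp, ← GrVect.total_comp,
          IsIso.hom_inv_id, GrVect.total_id, TensorProduct.map_id]
        rfl
      map_c := fun w => by
        have h : GrVect.total f.map (GrVect.total (inv f.map) w) = w := by
          rw [← LinearMap.comp_apply, ← GrVect.total_comp, IsIso.inv_hom_id, GrVect.total_id]
          rfl
        rw [← f.map_c, h] }
  hom_inv_id := FDGVertexCoalgebra.Hom.ext (IsIso.hom_inv_id f.map)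
  inv_hom_id := FDGVertexCoalgebra.Hom.ext (IsIso.inv_hom_id f.map)

/-- The canonical map from a graded vertex algebra to its double dual. -/
def FDGVertexAlgebra.toDoubleDual (A : FDGVertexAlgebra.{u, max u v} F) :
    A ⟶ FDGVertexCoalgebra.dual.{u, v} (FDGVertexAlgebra.dual.{u, v} A) where
  map := VertexDuality.toDoubleDual.{u, v} A.space
  map_Y x y n := by
    apply pairing_injective (GrVect.dual.{u, v} A.space)
    refine LinearMap.ext fun ξ => ?_
    -- Paired with `ξ`, both sides become `⟨Y(x) ξ, x ⊗ y⟩`, by the two adjunctions defining the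
    -- dual structures.
    refine Eq.trans (pairing_total_toDoubleDual.{u, v} _ ξ) ?_
    refine Eq.trans ?_ (FDGVertexCoalgebra.pairing_dual_Y.{u, v}
      (FDGVertexAlgebra.dual.{u, v} A) _ _ ξ n).symm
    refine Eq.trans ?_ (tensorPairing_total_toDoubleDual.{u, v} (x ⊗ₜ y) _).symm
    exact (FDGVertexAlgebra.tensorPairing_dual_Y.{u, v} A ξ x y n).symm
  map_vac := by
    apply pairing_injective (GrVect.dual.{u, v} A.space)
    refine LinearMap.ext fun ξ => ?_
    refine Eq.trans (pairing_total_toDoubleDual.{u, v} _ ξ) ?_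
    exact (LinearMap.congr_fun
      (FDGVertexCoalgebra.pairing_vac.{u, v} (FDGVertexAlgebra.dual.{u, v} A)) ξ).symm

/-- The canonical map from a graded vertex coalgebra to its double dual. -/
def FDGVertexCoalgebra.toDoubleDual (C : FDGVertexCoalgebra.{u, max u v} F) :
    C ⟶ FDGVertexAlgebra.dual.{u, v} (FDGVertexCoalgebra.dual.{u, v} C) where
  map := VertexDuality.toDoubleDual.{u, v} C.space
  map_Y w n := by
    apply tensorPairing_injective (GrVect.dual.{u, v} C.space)
    refine TensorProduct.ext' fun f g => ?_
    refine Eq.trans (tensorPairing_total_toDoubleDual.{u, v} _ _) ?_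
    refine Eq.trans ?_ (FDGVertexAlgebra.tensorPairing_dual_Y.{u, v}
      (FDGVertexCoalgebra.dual.{u, v} C) _ f g n).symm
    refine Eq.trans ?_ (pairing_total_toDoubleDual.{u, v} w _).symm
    exact (FDGVertexCoalgebra.pairing_dual_Y.{u, v} C f g w n).symm
  map_c w := by
    refine Eq.trans (pairing_total_toDoubleDual.{u, v} w _) ?_
    exact LinearMap.congr_fun (FDGVertexCoalgebra.pairing_vac.{u, v} C) w

/-- A graded vertex algebra is isomorphic to its double dual. -/
def FDGVertexAlgebra.doubleDualIso (A : FDGVertexAlgebra.{u, max u v} F) :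
    A ≅ FDGVertexCoalgebra.dual.{u, v} (FDGVertexAlgebra.dual.{u, v} A) :=
  have := A.finite
  have : IsIso (FDGVertexAlgebra.toDoubleDual.{u, v} A).map := isIso_toDoubleDual.{u, v}
  FDGVertexAlgebra.isoOfIsIso (FDGVertexAlgebra.toDoubleDual.{u, v} A)

/-- A graded vertex coalgebra is isomorphic to its double dual. -/
def FDGVertexCoalgebra.doubleDualIso (C : FDGVertexCoalgebra.{u, max u v} F) :
    C ≅ FDGVertexAlgebra.dual.{u, v} (FDGVertexCoalgebra.dual.{u, v} C) :=
  have := C.finite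
  have : IsIso (FDGVertexCoalgebra.toDoubleDual.{u, v} C).map := isIso_toDoubleDual.{u, v}
  FDGVertexCoalgebra.isoOfIsIso (FDGVertexCoalgebra.toDoubleDual.{u, v} C)

theorem toDoubleDual_naturality {V W : GrVect.{u, max u v} F} (f : V ⟶ W) :
    f ≫ toDoubleDual.{u, v} W = toDoubleDual.{u, v} V ≫
      (gradedDual.{u, v} F).map ((gradedDual.{u, v} F).map f.op).op := rfl

/-- The triangle identity: evaluating the evaluation functional of `v` at `f` returns `f v`. -/
theorem toDoubleDual_dual_comp (V : GrVect.{u, max u v} F) :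
    toDoubleDual.{u, v} (GrVect.dual.{u, v} V)
      ≫ (gradedDual.{u, v} F).map (toDoubleDual.{u, v} V).op = 𝟙 (GrVect.dual.{u, v} V) := rfl

theorem inv_comp_inv_eq_id {𝒞 : Type*} [Category 𝒞] {X Y : 𝒞} (i : X ≅ Y) (j : Y ≅ X)
    (h : i.hom ≫ j.hom = 𝟙 X) : j.inv ≫ i.inv = 𝟙 X := by
  rw [← Iso.trans_inv, show i ≪≫ j = Iso.refl X from Iso.ext h, Iso.refl_inv]

variable (F) in
/-- Graded dualization is a contravariant equivalence between graded vertex algebras and graded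
vertex coalgebras. -/
def dualityEquivalence :
    (FDGVertexAlgebra.{u, max u v} F)ᵒᵖ ≌ FDGVertexCoalgebra.{u, max u v} F where
  functor := dualCoalgebraFunctor.{u, v} F
  inverse := dualAlgebraFunctor.{u, v} F
  -- A unit component `op A ⟶ op A''` is a morphism `A'' ⟶ A`, so it is the inverse of the canonical
  -- map; likewise for the counit. The triangle identity is therefore obtained by inverting
  -- `toDoubleDual_dual_comp`.
  unitIso := (NatIso.ofComponents
    (F := dualCoalgebraFunctor.{u, v} F ⋙ dualAlgebraFunctor.{u, v} F) (G := 𝟭 _)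
    (fun A => (FDGVertexAlgebra.doubleDualIso.{u, v} A.unop).op)
    (fun f => congrArg Quiver.Hom.op
      (FDGVertexAlgebra.Hom.ext (toDoubleDual_naturality.{u, v} f.unop.map).symm))).symm
  counitIso := (NatIso.ofComponents
    (F := 𝟭 _) (G := dualAlgebraFunctor.{u, v} F ⋙ dualCoalgebraFunctor.{u, v} F)
    (fun C => FDGVertexCoalgebra.doubleDualIso.{u, v} C)
    (fun f => FDGVertexCoalgebra.Hom.ext (toDoubleDual_naturality.{u, v} f.map))).symm
  functor_unitIso_comp A := by
    have h : (FDGVertexCoalgebra.doubleDualIso.{u, v} (FDGVertexAlgebra.dual.{u, v} A.unop)).hom ≫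
        (dualCoalgebraFunctor.{u, v} F).map
          (FDGVertexAlgebra.doubleDualIso.{u, v} A.unop).hom.op = 𝟙 _ :=
      FDGVertexCoalgebra.Hom.ext (toDoubleDual_dual_comp.{u, v} A.unop.space)
    exact inv_comp_inv_eq_id _ ((dualCoalgebraFunctor.{u, v} F).mapIso
      (FDGVertexAlgebra.doubleDualIso.{u, v} A.unop).op) h

end Functors

end

end VertexDuality

/-! ### The duality theorem -/

open VertexDuality
theorem mainTheorem2 (F : Type u) [Field F] [CharZero F] :
    ∃ (e : (FDGVertexAlgebra.{u, max u v} F)ᵒᵖ ≌ FDGVertexCoalgebra.{u, max u v} F)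
      (α : e.functor ⋙ FDGVertexCoalgebra.forget F
        ≅ (FDGVertexAlgebra.forget F).op ⋙ gradedDual.{u, v} F)
      (β : e.inverse.leftOp ⋙ FDGVertexAlgebra.forget F
        ≅ (FDGVertexCoalgebra.forget F).op ⋙ gradedDual.{u, v} F),
      (∀ A : FDGVertexAlgebra.{u, max u v} F,
        IsDualCoalgebra.{u, v} A (e.functor.obj (op A)) (α.app (op A))) ∧
      (∀ C : FDGVertexCoalgebra.{u, max u v} F,
        IsDualAlgebra.{u, v} C (e.inverse.obj C).unop (β.app (op C))) ∧
      (∀ A : FDGVertexAlgebra.{u, max u v} F,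
        (FDGVertexAlgebra.forget F).map (e.unitInv.app (op A)).unop
            ≫ β.hom.app (op (e.functor.obj (op A)))
          = toDoubleDual.{u, v} A.space ≫ (gradedDual.{u, v} F).map (α.hom.app (op A)).op) ∧
      (∀ C : FDGVertexCoalgebra.{u, max u v} F,
        (FDGVertexCoalgebra.forget F).map (e.counitInv.app C)
            ≫ α.hom.app (e.inverse.obj C)
          = toDoubleDual.{u, v} C.space ≫ (gradedDual.{u, v} F).map (β.hom.app (op C)).op) := by
  -- The underlying graded spaces are the graded duals on the nose, so `α` and `β` are identities
  -- and the statements about the canonical maps hold by definition.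
  refine ⟨dualityEquivalence.{u, v} F, Iso.refl _, Iso.refl _, fun A => ⟨fun ξ v w n => ?_,
    fun ξ => ?_⟩, fun C => ⟨fun f g w n => ?_, fun w => ?_⟩, fun A => ?_, fun C => ?_⟩
  · change tensorPairing.{u, v} A.space (TensorProduct.map
      (GrVect.total (𝟙 (GrVect.dual.{u, v} A.space)))
      (GrVect.total (𝟙 (GrVect.dual.{u, v} A.space))) _) _
      = pairing.{u, v} A.space (GrVect.total (𝟙 (GrVect.dual.{u, v} A.space)) ξ) _
    rw [GrVect.total_id, TensorProduct.map_id]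
    exact FDGVertexAlgebra.tensorPairing_dual_Y.{u, v} A ξ v w n
  · change _ = pairing.{u, v} A.space (GrVect.total (𝟙 (GrVect.dual.{u, v} A.space)) ξ) _
    rw [GrVect.total_id]
    rfl
  · change pairing.{u, v} C.space (GrVect.total (𝟙 (GrVect.dual.{u, v} C.space)) _) _
      = tensorPairing.{u, v} C.space (GrVect.total (𝟙 (GrVect.dual.{u, v} C.space)) f ⊗ₜ
        GrVect.total (𝟙 (GrVect.dual.{u, v} C.space)) g) _
    rw [GrVect.total_id]
    exact FDGVertexCoalgebra.pairing_dual_Y.{u, v} C f g w n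
  · change pairing.{u, v} C.space (GrVect.total (𝟙 (GrVect.dual.{u, v} C.space)) _) _ = _
    rw [GrVect.total_id]
    exact LinearMap.congr_fun (FDGVertexCoalgebra.pairing_vac.{u, v} C) w
  · rfl
  · rfl
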